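/- **Setting.** Let $\mathcal H$ be a complex Hilbert space, $\mathcal L\subset\mathcal H$ a closed subspace, and $P_{\mathcal L}$ the orthogonal projection onto $\mathcal L$. For a (possibly unbounded) self-adjoint operator $B$ on $\mathcal H$ and an interval $J\subset\mathbb R$, let $E(B,J)$ be the orthogonal projection onto the closed linear span of the eigenvectors of $B$ with eigenvalues in $J$. Let $X=[0,1]$ or $X=[0,1]^2$. A family $\{B_x\}_{x\in X}$ of self-adjoint operators is called $\mathcal L$-tame if (i) the resolvent $(i-B_x)^{-1}$ depends continuously on $x\in X$ in the operator norm, and there is a $\delta>0$ such that (ii) for each $x$ the spectrum of $B_x$ in $(-\delta,\delta)$ is purely discrete (isolated eigenvalues of finite multiplicity), and (iii) $\|P_{\mathcal L}E(B_x,J)-E(B_x,J)P_{\mathcal L}\|<\frac14$ for every $x$ and every interval $J\subset(-\delta,\delta)$. For $X=[0,1]$ and $\delta$ as above, an admissible choice consists of a partition $0=t_0<t_1<\dots<t_{n+1}=1$ and numbers $\gamma_1,\dots,\gamma_{n+1}\in(-\delta,\delta)$ such that $\gamma_j\notin\operatorname{Spec}(B_t)$ for all $t\in[t_{j-1},t_j]$,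 $\gamma_1=\gamma_{n+1}\le0$, and $[\gamma_1,0)$ contains no points of the spectra of $B_0$ and $B_1$ (no condition if $\gamma_1=0$). Let $V_j$ be the linear span of the eigenvectors of $B_{t_j}$ with eigenvalues between $\gamma_j$ and $\gamma_{j+1}$, and let $m_{j+}$ be the positive index of inertia of the quadratic form $u\mapsto(u,(2P_{\mathcal L}-1)u)$ on $V_j$, i.e. the largest dimension of a subspace of $V_j$ on which the form is positive definite. The partial spectral flow of $\{B_t\}$ along $\mathcal L$ is $$\operatorname{sf}_{\mathcal L}\{B_t\}=\sum_{j=1}^n m_{j+}\,\operatorname{sign}(\gamma_j-\gamma_{j+1}),$$ and the ordinary spectral flow $\operatorname{sf}\{B_t\}$ of a family satisfying (i) and (ii) is given by the same formula with $\dim V_j$ in place of $m_{j+}$. **Theorem 1.** (a) Let $\{B_t\}_{t\in[0,1]}$ be an $\mathcal L$-tame family of self-adjoint operators. Then the family is also $\mathcal L^\perp$-tame; the numbers $\operatorname{sf}_{\mathcal L}\{B_t\}$, $\operatorname{sf}_{\mathcal L^\perp}\{B_t\}$ and $\operatorname{sf}\{B_t\}$ are well defined, i.e. for every suitable $\delta$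 an admissible choice exists, and the sum does not depend on $\delta$ or on the admissible choice; and $$\operatorname{sf}_{\mathcal L}\{B_t\}+\operatorname{sf}_{\mathcal L^\perp}\{B_t\}=\operatorname{sf}\{B_t\}.$$ (b) (Homotopy invariance.) Let $\{B(t,\tau)\}_{(t,\tau)\in[0,1]^2}$ be an $\mathcal L$-tame two-parameter family of self-adjoint operators. If $\operatorname{sf}_{\mathcal L}\{B(0,t)\}=\operatorname{sf}_{\mathcal L}\{B(1,t)\}$, then $\operatorname{sf}_{\mathcal L}\{B(t,0)\}=\operatorname{sf}_{\mathcal L}\{B(t,1)\}$, where in each of the four families $t$ runs over $[0,1]$. -/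

import Mathlib

namespace PartialFlow

noncomputable section

variable {H : Type*} [NormedAddCommGroup H] [InnerProductSpace ℂ H]

/-- The bounded operator `R` is the resolvent `(z - B)⁻¹` of the (possibly unbounded) operator `B`:
it maps `H` into the domain of `B` and is a two-sided inverse of `z - B`. -/
def IsResolventAt (B : H →ₗ.[ℂ] H) (z : ℂ) (R : H →L[ℂ] H) : Prop :=
  (∀ u : H, ∃ h : R u ∈ B.domain, z • R u - B ⟨R u, h⟩ = u) ∧
    ∀ v : B.domain, R (z • (v : H) - B v) = v

/-- The set of real points of the spectrum of `B` (all of the spectrum if `B` is self-adjoint):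
those `c` for which `c - B` has no bounded everywhere defined inverse. -/
def spec (B : H →ₗ.[ℂ] H) : Set ℝ :=
  {c : ℝ | ¬ ∃ R : H →L[ℂ] H, IsResolventAt B (c : ℂ) R}

/-- The eigenspace of `B` for the real number `c` (it is `⊥` if `c` is not an eigenvalue). -/
def eigenspace (B : H →ₗ.[ℂ] H) (c : ℝ) : Submodule ℂ H where
  carrier := {u | ∃ h : u ∈ B.domain, B ⟨u, h⟩ = (c : ℂ) • u}
  zero_mem' := ⟨B.domain.zero_mem, by
    have : (⟨0, B.domain.zero_mem⟩ : B.domain) = 0 := rfl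
    rw [this, B.map_zero, smul_zero]⟩
  add_mem' := by
    rintro u v ⟨hu, hu'⟩ ⟨hv, hv'⟩
    refine ⟨B.domain.add_mem hu hv, ?_⟩
    have : (⟨u + v, B.domain.add_mem hu hv⟩ : B.domain) = ⟨u, hu⟩ + ⟨v, hv⟩ := rfl
    rw [this, B.map_add, hu', hv', smul_add]
  smul_mem' := by
    rintro a u ⟨hu, hu'⟩
    refine ⟨B.domain.smul_mem a hu, ?_⟩
    have : (⟨a • u, B.domain.smul_mem a hu⟩ : B.domain) = a • ⟨u, hu⟩ := rfl
    rw [this, B.map_smul, hu', smul_comm]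

/-- The linear span of the eigenvectors of `B` with eigenvalues in `J`. -/
def eigenSpan (B : H →ₗ.[ℂ] H) (J : Set ℝ) : Submodule ℂ H :=
  ⨆ c ∈ J, eigenspace B c

/-- The spectrum of `B` in `J` is purely discrete: each of its points is an isolated point of the
spectrum and an eigenvalue of finite multiplicity. -/
def HasDiscreteSpectrumOn (B : H →ₗ.[ℂ] H) (J : Set ℝ) : Prop :=
  ∀ c ∈ spec B ∩ J,
    (∃ ε > 0, ∀ d ∈ spec B, |d - c| < ε → d = c) ∧
      eigenspace B c ≠ ⊥ ∧ FiniteDimensional ℂ (eigenspace B c)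

/-- The orthogonal projection `E(B, J)` onto the closed linear span of the eigenvectors of `B`
with eigenvalues in `J`. -/
def eigenProj [CompleteSpace H] (B : H →ₗ.[ℂ] H) (J : Set ℝ) : H →L[ℂ] H :=
  (eigenSpan B J).topologicalClosure.starProjection

/-- Norm continuity of the resolvents `(i - B_x)⁻¹` in the parameter `x`, and pure discreteness of
the spectra in `(-δ, δ)`. -/
structure IsRegularWith {X : Type*} [TopologicalSpace X] (B : X → H →ₗ.[ℂ] H) (δ : ℝ) : Prop where
  pos : 0 < δ
  continuous_resolvent :
    ∃ R : X → H →L[ℂ] H, Continuous R ∧ ∀ x, IsResolventAt (B x) Complex.I (R x)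
  discrete : ∀ x, HasDiscreteSpectrumOn (B x) (Set.Ioo (-δ) δ)

/-- The family `B` is `L`-tame with constant `δ`. The parameter space `X` is the unit interval or
the unit square below. -/
structure IsTameWith [CompleteSpace H] {X : Type*} [TopologicalSpace X]
    (L : Submodule ℂ H) [L.HasOrthogonalProjection] (B : X → H →ₗ.[ℂ] H) (δ : ℝ) : Prop
    extends IsRegularWith B δ where
  commutator : ∀ x, ∀ J : Set ℝ, J.OrdConnected → J ⊆ Set.Ioo (-δ) δ →
    ‖L.starProjection * eigenProj (B x) J - eigenProj (B x) J * L.starProjection‖ < 1 / 4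

/-- The family `B` is `L`-tame. -/
def IsTame [CompleteSpace H] {X : Type*} [TopologicalSpace X]
    (L : Submodule ℂ H) [L.HasOrthogonalProjection] (B : X → H →ₗ.[ℂ] H) : Prop :=
  ∃ δ : ℝ, IsTameWith L B δ

/-- The quadratic form `A[u] = (u, (2 P_L - 1) u)` (its values are real). -/
def form (L : Submodule ℂ H) [L.HasOrthogonalProjection] (u : H) : ℝ :=
  (inner ℂ u ((2 : ℂ) • L.starProjection u - u)).re

/-- The positive index of inertia of the restriction of `form L` to the finite-dimensional
subspace `V`: the largest dimension of a subspace of `V` on which the form is positive definite. -/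
def posIndex (L : Submodule ℂ H) [L.HasOrthogonalProjection] (V : Submodule ℂ H) : ℕ :=
  sSup {k : ℕ | ∃ W : Submodule ℂ H, W ≤ V ∧ FiniteDimensional ℂ W ∧ Module.finrank ℂ W = k ∧
    ∀ u ∈ W, u ≠ 0 → 0 < form L u}

/-- The choices entering the definition of the (partial) spectral flow: a partition
`0 = t₀ < t₁ < … < tₙ₊₁ = 1` and levels `γ₁, …, γₙ₊₁` in `(-δ, δ)`. The level on the interval
`[tⱼ, tⱼ₊₁]`, `j = 0, …, n`, is `lev j`. -/
structure FlowChoice (B : unitInterval → H →ₗ.[ℂ] H) (δ : ℝ) where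
  n : ℕ
  t : Fin (n + 2) → unitInterval
  lev : Fin (n + 1) → ℝ
  strictMono : StrictMono t
  t_zero : t 0 = 0
  t_last : t (Fin.last (n + 1)) = 1
  lev_mem : ∀ j, lev j ∈ Set.Ioo (-δ) δ
  lev_notMem_spec : ∀ j, ∀ s ∈ Set.Icc (t j.castSucc) (t j.succ), lev j ∉ spec (B s)
  lev_zero_eq_last : lev 0 = lev (Fin.last n)
  lev_zero_nonpos : lev 0 ≤ 0
  ends_free : ∀ c ∈ Set.Ico (lev 0) 0, c ∉ spec (B 0) ∧ c ∉ spec (B 1)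

namespace FlowChoice

variable {B : unitInterval → H →ₗ.[ℂ] H} {δ : ℝ}

/-- The span `Vⱼ`, `j = 1, …, n`, of the eigenvectors of `B` at the interior partition point `tⱼ`
with eigenvalues between the levels `γⱼ` and `γⱼ₊₁` on the two adjacent intervals (the index is
shifted by one: `j : Fin n` starts at `0`). -/
def V (c : FlowChoice B δ) (j : Fin c.n) : Submodule ℂ H :=
  eigenSpan (B (c.t j.succ.castSucc)) (Set.uIoo (c.lev j.castSucc) (c.lev j.succ))

/-- The sum of `m₊(Vⱼ) sign (γⱼ - γⱼ₊₁)`. -/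
def partialSum (c : FlowChoice B δ) (L : Submodule ℂ H) [L.HasOrthogonalProjection] : ℤ :=
  ∑ j : Fin c.n, (posIndex L (c.V j) : ℤ) *
    (SignType.sign (c.lev j.castSucc - c.lev j.succ) : ℤ)

/-- The sum of `dim Vⱼ sign (γⱼ - γⱼ₊₁)`. -/
def fullSum (c : FlowChoice B δ) : ℤ :=
  ∑ j : Fin c.n, (Module.finrank ℂ (c.V j) : ℤ) *
    (SignType.sign (c.lev j.castSucc - c.lev j.succ) : ℤ)

end FlowChoice

open Classical in
/-- The partial spectral flow of the `L`-tame family `B` along `L`, computed from some admissible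
choice (and `0` if there is none). -/
def partialSpectralFlow [CompleteSpace H] (L : Submodule ℂ H) [L.HasOrthogonalProjection]
    (B : unitInterval → H →ₗ.[ℂ] H) : ℤ :=
  if h : ∃ m : ℤ, ∃ δ : ℝ, IsTameWith L B δ ∧ ∃ c : FlowChoice B δ, c.partialSum L = m then
    h.choose else 0

open Classical in
/-- The ordinary spectral flow of the family `B`, computed from some admissible choice
(and `0` if there is none). -/
def spectralFlow (B : unitInterval → H →ₗ.[ℂ] H) : ℤ :=
  if h : ∃ m : ℤ, ∃ δ : ℝ, IsRegularWith B δ ∧ ∃ c : FlowChoice B δ, c.fullSum = m then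
    h.choose else 0

end

end PartialFlow

/-! Write `J = 2 P_L - 1`, a unitary reflection. For a spectral subspace `V`, the commutator bound
1/4 says that `J` maps `u ∈ V` into `V` up to an error below `‖u‖ / 2`. The compression of `J` to
`V` therefore has no eigenvalue in `[-1/2, 1/2]`, and `V` splits into a positive and a negative part
with a uniform gap (`AlmostCommutes.exists_splitting`). Three facts follow: the indices along `L`
and `Lᗮ` add up to `dim V`, which gives the sum formula term by term; the index is additive over
orthogonal spectral subspaces (`posIndex_sup`); and it is unchanged when the projection moves by
less than 1/4 (`posIndex_eq_of_norm_starProjection_sub_lt`). Since spectral projections between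
levels outside the spectrum are norm continuous (`IsRegularWith.continuousAt_eigenProj`), both `dim`
and the positive index are additive and locally constant, which is recorded as `IsFlowIndex`.

The rest is topology. The signed index between two levels is an additive cocycle. For fixed `p`, the
signed index from `p` to a reference level just below 0 is a function on the open set where `p` is
not in the spectrum; two such functions differ by a locally constant one. They are local primitives
of a closed form, and on the square they glue to a global potential `F`
(`exists_isPotentialOn_unitSquare`). The sum for any admissible choice telescopes to the difference
of `F` at the ends of the path (`IsFlowIndex.indexSum_eq`). Hence it does not depend on the choice,
and homotopy invariance is an identity between the four corner values of `F`. -/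

open Filter Topology
namespace PartialFlow

/-! ### The quadratic form of the reflection in `L` -/

section Form

variable {H : Type*} [NormedAddCommGroup H] [InnerProductSpace ℂ H]
variable (L : Submodule ℂ H) [L.HasOrthogonalProjection]

theorem form_eq_re_inner_reflection (u : H) : form L u = (inner ℂ u (L.reflection u)).re := by
  rw [form, Submodule.reflection_apply, two_smul, two_smul]

theorem form_eq (u : H) : form L u = 2 * ‖L.starProjection u‖ ^ 2 - ‖u‖ ^ 2 := by
  have h1 := L.re_inner_starProjection_eq_normSq u
  rw [← inner_conj_symm, RCLike.conj_re] at h1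
  have h2 := inner_self_eq_norm_sq (𝕜 := ℂ) u
  rw [RCLike.re_to_complex] at h1 h2
  rw [form, inner_sub_right, inner_smul_right, Complex.sub_re, h2]
  simp only [Submodule.starProjection_apply] at h1 ⊢
  rw [Complex.mul_re, h1]
  simp

theorem form_orthogonal (u : H) : form Lᗮ u = -form L u := by
  rw [form_eq, form_eq]
  linarith [L.norm_sq_eq_add_norm_sq_starProjection u (𝕜 := ℂ)]

theorem abs_form_sub_le (u v : H) : |form L u - form L v| ≤ ‖u - v‖ * (‖u‖ + ‖v‖) := by
  have h : form L u - form L v =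
      (inner ℂ (u - v) (L.reflection u)).re + (inner ℂ v (L.reflection (u - v))).re := by
    simp only [form_eq_re_inner_reflection, map_sub, inner_sub_left, inner_sub_right,
      Complex.sub_re]
    ring
  rw [h]
  refine (abs_add_le _ _).trans ?_
  have h1 := (Complex.abs_re_le_norm _).trans (norm_inner_le_norm (𝕜 := ℂ) (u - v) (L.reflection u))
  have h2 := (Complex.abs_re_le_norm _).trans (norm_inner_le_norm (𝕜 := ℂ) v (L.reflection (u - v)))
  rw [LinearIsometryEquiv.norm_map] at h1 h2
  linarith

theorem form_add (u v : H) :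
    form L (u + v) = form L u + form L v + 2 * (inner ℂ u (L.reflection v)).re := by
  have h : (inner ℂ v (L.reflection u)).re = (inner ℂ u (L.reflection v)).re := by
    have := inner_conj_symm (𝕜 := ℂ) v (L.reflection u)
    rw [← this, Complex.conj_re, Submodule.reflection_apply, Submodule.reflection_apply,
      inner_sub_left, inner_sub_right, two_smul, two_smul, inner_add_left, inner_add_right,
      Submodule.inner_starProjection_left_eq_right]
  simp only [form_eq_re_inner_reflection, map_add, inner_add_left, inner_add_right, Complex.add_re,
    h]
  ring

end Form

/-! ### Positive index on almost commuting subspaces: gap, additivity, stability -/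

section Index

variable {H : Type*} [NormedAddCommGroup H] [InnerProductSpace ℂ H]
variable (L : Submodule ℂ H) [L.HasOrthogonalProjection]

theorem le_finrank_of_posIndex_set (V : Submodule ℂ H) [FiniteDimensional ℂ V] {k : ℕ}
    (h : ∃ W : Submodule ℂ H, W ≤ V ∧ FiniteDimensional ℂ W ∧ Module.finrank ℂ W = k ∧
      ∀ u ∈ W, u ≠ 0 → 0 < form L u) : k ≤ Module.finrank ℂ V := by
  obtain ⟨W, hW, -, rfl, -⟩ := h
  exact Submodule.finrank_mono hW

theorem finrank_le_posIndex {V W : Submodule ℂ H} [FiniteDimensional ℂ V] (hW : W ≤ V)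
    (hpos : ∀ u ∈ W, u ≠ 0 → 0 < form L u) : Module.finrank ℂ W ≤ posIndex L V :=
  le_csSup ⟨Module.finrank ℂ V, fun _ h => le_finrank_of_posIndex_set L V h⟩
    ⟨W, hW, Submodule.finiteDimensional_of_le hW, rfl, hpos⟩

theorem exists_finrank_eq_posIndex (V : Submodule ℂ H) [FiniteDimensional ℂ V] :
    ∃ W : Submodule ℂ H, W ≤ V ∧ FiniteDimensional ℂ W ∧ Module.finrank ℂ W = posIndex L V ∧
      ∀ u ∈ W, u ≠ 0 → 0 < form L u := by
  refine Nat.sSup_mem (s := {k : ℕ | ∃ W : Submodule ℂ H, W ≤ V ∧ FiniteDimensional ℂ W ∧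
    Module.finrank ℂ W = k ∧ ∀ u ∈ W, u ≠ 0 → 0 < form L u})
    ⟨0, ⊥, bot_le, inferInstance, finrank_bot ℂ H, ?_⟩
    ⟨Module.finrank ℂ V, fun _ h => le_finrank_of_posIndex_set L V h⟩
  intro u hu h0
  exact absurd ((Submodule.mem_bot ℂ).1 hu) h0

theorem finrank_add_finrank_le_of_le_of_disjoint {V P N : Submodule ℂ H} [FiniteDimensional ℂ V]
    (hP : P ≤ V) (hN : N ≤ V) (h : Disjoint P N) :
    Module.finrank ℂ P + Module.finrank ℂ N ≤ Module.finrank ℂ V := by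
  have := Submodule.finiteDimensional_of_le hP
  have := Submodule.finiteDimensional_of_le hN
  have h1 := Submodule.finrank_sup_add_finrank_inf_eq P N
  rw [h.eq_bot, finrank_bot, add_zero] at h1
  rw [← h1]
  exact Submodule.finrank_mono (sup_le hP hN)

theorem posIndex_add_posIndex_orthogonal_le (V : Submodule ℂ H) [FiniteDimensional ℂ V] :
    posIndex L V + posIndex Lᗮ V ≤ Module.finrank ℂ V := by
  obtain ⟨P, hPV, -, hP, hPpos⟩ := exists_finrank_eq_posIndex L V
  obtain ⟨N, hNV, -, hN, hNpos⟩ := exists_finrank_eq_posIndex Lᗮ V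
  rw [← hP, ← hN]
  refine finrank_add_finrank_le_of_le_of_disjoint hPV hNV (Submodule.disjoint_def.2 ?_)
  intro u hu hu'
  by_contra h0
  have h1 := hPpos u hu h0
  have h2 := hNpos u hu' h0
  rw [form_orthogonal] at h2
  linarith

/-- The condition `‖[P_L, P_V]‖ < 1/4`. -/
def AlmostCommutes (V : Submodule ℂ H) [V.HasOrthogonalProjection] : Prop :=
  ‖L.starProjection * V.starProjection - V.starProjection * L.starProjection‖ < 1 / 4

variable {L}

/-- Since `P_V u = u`, the component of `J u` orthogonal to `V` is twice the commutator applied to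
`u`, so 1/4 becomes 1/2. -/
theorem AlmostCommutes.norm_reflection_sub_lt {V : Submodule ℂ H} [V.HasOrthogonalProjection]
    (h : AlmostCommutes L V) {u : H} (hu : u ∈ V) (h0 : u ≠ 0) :
    ‖L.reflection u - V.starProjection (L.reflection u)‖ < 1 / 2 * ‖u‖ := by
  have h1 := ContinuousLinearMap.le_opNorm
    (L.starProjection * V.starProjection - V.starProjection * L.starProjection) u
  have h2 : L.reflection u - V.starProjection (L.reflection u) = (2 : ℂ) •
      (L.starProjection * V.starProjection - V.starProjection * L.starProjection) u := by
    simp only [Submodule.reflection_apply, sub_apply, mul_apply_eq_comp,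
      Submodule.starProjection_eq_self_iff.2 hu, map_sub, two_smul, map_add]
    abel
  rw [h2, norm_smul]
  have h3 : 0 < ‖u‖ := norm_pos_iff.2 h0
  have h4 := mul_lt_mul_of_pos_right h h3
  simp only [Complex.norm_ofNat]
  linarith

theorem AlmostCommutes.two_mul_re_inner_le {V W : Submodule ℂ H} [V.HasOrthogonalProjection]
    (h : AlmostCommutes L V) (hVW : V ⟂ W) {u v : H} (hu : u ∈ W) (hv : v ∈ V) :
    |2 * (inner ℂ u (L.reflection v)).re| ≤ ‖u‖ * ‖v‖ := by
  have h1 : inner ℂ u (L.reflection v) =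
      inner ℂ u (L.reflection v - V.starProjection (L.reflection v)) := by
    rw [inner_sub_right, hVW.symm.inner_eq hu (V.starProjection_apply_mem _), sub_zero]
  rcases eq_or_ne v 0 with rfl | h0
  · simp
  have h2 := h.norm_reflection_sub_lt hv h0
  rw [h1, abs_mul, abs_two]
  have h3 := (Complex.abs_re_le_norm _).trans (norm_inner_le_norm (𝕜 := ℂ) u
    (L.reflection v - V.starProjection (L.reflection v)))
  nlinarith [norm_nonneg u, mul_le_mul_of_nonneg_left h2.le (norm_nonneg u)]

/-- The compression of the reflection in `L` to `V`. -/
noncomputable def compression (L V : Submodule ℂ H) [L.HasOrthogonalProjection] [V.HasOrthogonalProjection] :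
    V →ₗ[ℂ] V :=
  (V.orthogonalProjectionOnto : H →ₗ[ℂ] V) ∘ₗ
    (L.reflection.toLinearEquiv : H →ₗ[ℂ] H) ∘ₗ V.subtype

theorem coe_compression_apply (V : Submodule ℂ H) [V.HasOrthogonalProjection] (v : V) :
    (compression L V v : H) = V.starProjection (L.reflection v) := rfl

theorem inner_compression (V : Submodule ℂ H) [V.HasOrthogonalProjection] (u v : V) :
    inner ℂ u (compression L V v) = inner ℂ (u : H) (L.reflection v) := by
  rw [Submodule.coe_inner, coe_compression_apply, ← Submodule.inner_starProjection_left_eq_right,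
    Submodule.starProjection_eq_self_iff.2 u.2]

theorem isSymmetric_compression (V : Submodule ℂ H) [V.HasOrthogonalProjection] :
    (compression L V).IsSymmetric := by
  intro u v
  rw [inner_compression, ← inner_conj_symm, inner_compression, inner_conj_symm,
    Submodule.reflection_apply, Submodule.reflection_apply,
    inner_sub_left, inner_sub_right, two_smul, two_smul, inner_add_left, inner_add_right,
      Submodule.inner_starProjection_left_eq_right]

/-- By Pythagoras `‖u‖² = ‖J u‖²` is `r² ‖u‖²` plus the squared defect, which is below `‖u‖² / 4`;
so even `r² > 3/4`. -/
theorem AlmostCommutes.half_lt_abs_of_eigenvector {V : Submodule ℂ H} [V.HasOrthogonalProjection]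
    (h : AlmostCommutes L V) {u : V} (h0 : u ≠ 0) {r : ℝ} (hu : compression L V u = (r : ℂ) • u) :
    1 / 2 < |r| := by
  have h0' : (u : H) ≠ 0 := fun hh => h0 (Subtype.ext hh)
  have h1 := h.norm_reflection_sub_lt u.2 h0'
  have h2 := V.norm_sq_eq_add_norm_sq_starProjection (L.reflection (u : H)) (𝕜 := ℂ)
  rw [Submodule.starProjection_orthogonal] at h2
  simp only [sub_apply, ContinuousLinearMap.id_apply, LinearIsometryEquiv.norm_map] at h2
  rw [← coe_compression_apply] at h1 h2
  rw [hu] at h1 h2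
  have h3 : ‖((r : ℂ) • u : V)‖ = |r| * ‖(u : H)‖ := by
    rw [norm_smul, Complex.norm_real]; rfl
  rw [Submodule.coe_norm] at h3
  rw [h3] at h2
  have h4 : 0 < ‖(u : H)‖ := norm_pos_iff.2 h0'
  by_contra! h5
  have h6 : |r| * ‖(u : H)‖ ≤ 1 / 2 * ‖(u : H)‖ := by gcongr
  have h7 : 0 ≤ |r| * ‖(u : H)‖ := by positivity
  nlinarith [norm_nonneg (L.reflection (u : H) - ((r : ℂ) • u : V))]

theorem inner_map_eq_sum {E ι : Type*} [NormedAddCommGroup E] [InnerProductSpace ℂ E] [Fintype ι]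
    (T : E →ₗ[ℂ] E) (b : OrthonormalBasis ι ℂ E) (l : ι → ℝ) (hb : ∀ i, T (b i) = (l i : ℂ) • b i)
    (v : E) : (inner ℂ v (T v)).re = ∑ i, l i * ‖inner ℂ (b i) v‖ ^ 2 := by
  conv_lhs => rw [← b.sum_repr' v, map_sum, inner_sum, Complex.re_sum]
  refine Finset.sum_congr rfl fun i _ => ?_
  rw [map_smul, hb, b.sum_repr' v, inner_smul_right, inner_smul_right, ← inner_conj_symm v (b i),
    mul_left_comm, RCLike.mul_conj, Complex.re_ofReal_mul]
  norm_cast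

theorem inner_eq_zero_of_mem_span {E ι : Type*} [NormedAddCommGroup E] [InnerProductSpace ℂ E]
    [Fintype ι] (b : OrthonormalBasis ι ℂ E) {S : Set ι} {i : ι} (hi : i ∉ S) {v : E}
    (hv : v ∈ Submodule.span ℂ (b '' S)) : inner ℂ (b i) v = 0 := by
  induction hv using Submodule.span_induction with
  | mem x hx =>
    obtain ⟨j, hj, rfl⟩ := hx
    exact b.orthonormal.inner_eq_zero fun hij => hi (hij ▸ hj)
  | zero => simp
  | add x y _ _ hx hy => rw [inner_add_right, hx, hy, add_zero]
  | smul a x _ hx => rw [inner_smul_right, hx, mul_zero]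

theorem lt_re_inner_map_of_mem_span {E ι : Type*} [NormedAddCommGroup E] [InnerProductSpace ℂ E]
    [Fintype ι] (T : E →ₗ[ℂ] E) (b : OrthonormalBasis ι ℂ E) (l : ι → ℝ)
    (hb : ∀ i, T (b i) = (l i : ℂ) • b i) {c : ℝ} {S : Set ι} (hS : ∀ i ∈ S, c < l i) {v : E}
    (hv : v ∈ Submodule.span ℂ (b '' S)) (h0 : v ≠ 0) :
    c * ‖v‖ ^ 2 < (inner ℂ v (T v)).re := by
  rw [inner_map_eq_sum T b l hb, ← b.sum_sq_norm_inner_right, Finset.mul_sum]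
  have key : ∀ i, inner ℂ (b i) v ≠ 0 → c < l i := fun i hi =>
    hS i (by_contra fun hi' => hi (inner_eq_zero_of_mem_span b hi' hv))
  refine Finset.sum_lt_sum (fun i _ => ?_) ?_
  · by_cases hi : inner ℂ (b i) v = 0
    · simp [hi]
    · exact mul_le_mul_of_nonneg_right (key i hi).le (by positivity)
  · by_contra! hall
    refine h0 (b.repr.map_eq_zero_iff.1 ?_)
    ext i
    rw [b.repr_apply_apply]
    by_contra hi
    refine absurd (hall i (Finset.mem_univ i)) (not_le.2 ?_)
    exact mul_lt_mul_of_pos_right (key i hi) (pow_pos (norm_pos_iff.2 hi) 2)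

theorem finrank_span_orthonormalBasis_image {E ι : Type*} [NormedAddCommGroup E]
    [InnerProductSpace ℂ E] [Fintype ι] (b : OrthonormalBasis ι ℂ E) (S : Finset ι) :
    Module.finrank ℂ (Submodule.span ℂ (b '' S)) = S.card := by
  classical
  have h := b.orthonormal.linearIndependent
  rw [← Finset.coe_image, finrank_span_finset_eq_card, Finset.card_image_of_injective _ h.injective]
  rw [Finset.coe_image]
  exact (h.linearIndepOn S).id_image

/-- Diagonalise the compression of `J` and sort an eigenbasis by the sign of the eigenvalue. The gap
ensures that eigenvalues not above 1/2 are below -1/2, so no basis vector is lost. -/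
theorem AlmostCommutes.exists_splitting {V : Submodule ℂ H} [V.HasOrthogonalProjection]
    [FiniteDimensional ℂ V] (h : AlmostCommutes L V) :
    ∃ P N : Submodule ℂ H, P ≤ V ∧ N ≤ V ∧
      Module.finrank ℂ P + Module.finrank ℂ N = Module.finrank ℂ V ∧
      (∀ u ∈ P, u ≠ 0 → 1 / 2 * ‖u‖ ^ 2 < form L u) ∧
      ∀ u ∈ N, u ≠ 0 → 1 / 2 * ‖u‖ ^ 2 < form Lᗮ u := by
  classical
  have hT := isSymmetric_compression (L := L) V
  set b := hT.eigenvectorBasis rfl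
  set l := hT.eigenvalues rfl
  have hb : ∀ i, compression L V (b i) = (l i : ℂ) • b i := hT.apply_eigenvectorBasis rfl
  have hl : ∀ i, 1 / 2 < |l i| := fun i =>
    h.half_lt_abs_of_eigenvector (b.orthonormal.ne_zero i) (hb i)
  set S : Finset (Fin (Module.finrank ℂ V)) := {i | 1 / 2 < l i}
  have hS : ∀ i ∈ (S : Set (Fin (Module.finrank ℂ V))), 1 / 2 < l i := fun i hi => by
    simpa [S] using hi
  have hSc : ∀ i ∈ ((Sᶜ : Finset _) : Set (Fin (Module.finrank ℂ V))), 1 / 2 < -l i := by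
    intro i hi
    have hi' : ¬ 1 / 2 < l i := by simpa [S] using hi
    exact (lt_abs.1 (hl i)).resolve_left hi'
  refine ⟨(Submodule.span ℂ (b '' S)).map V.subtype, (Submodule.span ℂ (b '' (Sᶜ : Finset _))).map
    V.subtype, Submodule.map_subtype_le _ _, Submodule.map_subtype_le _ _, ?_, ?_, ?_⟩
  · rw [Submodule.finrank_map_subtype_eq, Submodule.finrank_map_subtype_eq,
      finrank_span_orthonormalBasis_image, finrank_span_orthonormalBasis_image,
      Finset.card_add_card_compl, Fintype.card_fin]
  · rintro _ ⟨u, hu, rfl⟩ h0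
    have h0' : u ≠ 0 := fun hh => h0 (by simp [hh])
    have := lt_re_inner_map_of_mem_span _ b l hb hS hu h0'
    rw [inner_compression] at this
    rw [form_eq_re_inner_reflection]
    exact this
  · rintro _ ⟨u, hu, rfl⟩ h0
    have h0' : u ≠ 0 := fun hh => h0 (by simp [hh])
    have := lt_re_inner_map_of_mem_span (-compression L V) b (fun i => -l i)
      (fun i => by simp [hb]) hSc hu h0'
    rw [LinearMap.neg_apply, inner_neg_right, inner_compression] at this
    rw [form_orthogonal, form_eq_re_inner_reflection]
    exact this

theorem pos_of_half_norm_sq_lt {E : Type*} [SeminormedAddCommGroup E] {r : ℝ} {u : E}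
    (h : 1 / 2 * ‖u‖ ^ 2 < r) : 0 < r :=
  lt_of_le_of_lt (by positivity) h

/-- The parts of the splitting bound the two indices from below and have total dimension `dim V`;
the indices themselves cannot exceed that total, so equality holds throughout. -/
theorem AlmostCommutes.exists_maximal {V : Submodule ℂ H} [V.HasOrthogonalProjection]
    [FiniteDimensional ℂ V] (h : AlmostCommutes L V) :
    posIndex L V + posIndex Lᗮ V = Module.finrank ℂ V ∧
    (∃ P ≤ V, Module.finrank ℂ P = posIndex L V ∧
      ∀ u ∈ P, u ≠ 0 → 1 / 2 * ‖u‖ ^ 2 < form L u) ∧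
    ∃ N ≤ V, Module.finrank ℂ N = posIndex Lᗮ V ∧
      ∀ u ∈ N, u ≠ 0 → 1 / 2 * ‖u‖ ^ 2 < form Lᗮ u := by
  obtain ⟨P, N, hPV, hNV, hd, hP, hN⟩ := h.exists_splitting
  have h1 := finrank_le_posIndex L hPV fun u hu h0 => pos_of_half_norm_sq_lt (hP u hu h0)
  have h2 := finrank_le_posIndex Lᗮ hNV fun u hu h0 => pos_of_half_norm_sq_lt (hN u hu h0)
  have h3 := posIndex_add_posIndex_orthogonal_le L V
  exact ⟨by omega, ⟨P, hPV, by omega, hP⟩, ⟨N, hNV, by omega, hN⟩⟩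

theorem AlmostCommutes.posIndex_add_posIndex_orthogonal {V : Submodule ℂ H}
    [V.HasOrthogonalProjection] [FiniteDimensional ℂ V] (h : AlmostCommutes L V) :
    posIndex L V + posIndex Lᗮ V = Module.finrank ℂ V :=
  h.exists_maximal.1

theorem AlmostCommutes.orthogonal {V : Submodule ℂ H} [V.HasOrthogonalProjection]
    (h : AlmostCommutes L V) : AlmostCommutes Lᗮ V := by
  have h1 : Lᗮ.starProjection = 1 - L.starProjection := Submodule.starProjection_orthogonal L
  unfold AlmostCommutes at *
  rw [h1, sub_mul, mul_sub, one_mul, mul_one, sub_sub_sub_cancel_left, norm_sub_rev]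
  exact h

theorem exists_finrank_eq_posIndex_of_almostCommutes {V : Submodule ℂ H}
    [V.HasOrthogonalProjection] [FiniteDimensional ℂ V] (h : AlmostCommutes L V) :
    ∃ P ≤ V, Module.finrank ℂ P = posIndex L V ∧
      ∀ u ∈ P, u ≠ 0 → 1 / 2 * ‖u‖ ^ 2 < form L u :=
  h.exists_maximal.2.1

theorem finrank_sup_of_isOrtho {V W : Submodule ℂ H} [FiniteDimensional ℂ V]
    [FiniteDimensional ℂ W] (h : V ⟂ W) :
    Module.finrank ℂ (V ⊔ W : Submodule ℂ H) = Module.finrank ℂ V + Module.finrank ℂ W := by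
  have h1 := Submodule.finrank_sup_add_finrank_inf_eq V W
  rwa [h.disjoint.eq_bot, finrank_bot, add_zero] at h1

theorem AlmostCommutes.posIndex_add_posIndex_le {V W : Submodule ℂ H} [V.HasOrthogonalProjection]
    [W.HasOrthogonalProjection] [FiniteDimensional ℂ V] [FiniteDimensional ℂ W]
    (hV : AlmostCommutes L V) (hW : AlmostCommutes L W) (hVW : V ⟂ W) :
    posIndex L V + posIndex L W ≤ posIndex L (V ⊔ W) := by
  obtain ⟨P, hPV, hPd, hP⟩ := exists_finrank_eq_posIndex_of_almostCommutes hV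
  obtain ⟨Q, hQW, hQd, hQ⟩ := exists_finrank_eq_posIndex_of_almostCommutes hW
  have := Submodule.finiteDimensional_of_le hPV
  have := Submodule.finiteDimensional_of_le hQW
  rw [← hPd, ← hQd, ← finrank_sup_of_isOrtho (hVW.mono hPV hQW)]
  -- On `u + v` the diagonal terms give at least `(‖u‖² + ‖v‖²) / 2` and the cross term at most `‖u‖
  -- ‖v‖` in absolute value. Strict positivity comes from a nonzero summand.
  refine finrank_le_posIndex L (sup_le_sup hPV hQW) fun w hw h0 => ?_
  obtain ⟨u, hu, v, hv, rfl⟩ := Submodule.mem_sup.1 hw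
  have h1 := abs_le.1 (hW.two_mul_re_inner_le hVW.symm (hPV hu) (hQW hv))
  rw [form_add]
  have h2 := sq_nonneg (‖u‖ - ‖v‖)
  have z : form L 0 = 0 := by simp [form]
  have hu' : 1 / 2 * ‖u‖ ^ 2 ≤ form L u := by
    rcases eq_or_ne u 0 with rfl | hu0
    · simp [z]
    · exact (hP u hu hu0).le
  rcases eq_or_ne v 0 with rfl | hv0
  · rw [add_zero] at h0
    have := hP u hu h0
    simp only [z, map_zero, inner_zero_right, Complex.zero_re, mul_zero, add_zero]
    exact pos_of_half_norm_sq_lt this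
  · have := hQ v hv hv0
    nlinarith

/-- Superadditivity holds along both `L` and `Lᗮ`; since the dimensions add exactly, neither
inequality can be strict. -/
theorem posIndex_sup {V W : Submodule ℂ H} [V.HasOrthogonalProjection]
    [W.HasOrthogonalProjection] [FiniteDimensional ℂ V] [FiniteDimensional ℂ W]
    (hV : AlmostCommutes L V) (hW : AlmostCommutes L W) (hVW : V ⟂ W) :
    posIndex L (V ⊔ W) = posIndex L V + posIndex L W := by
  have h1 := hV.posIndex_add_posIndex_le hW hVW
  have h2 := hV.orthogonal.posIndex_add_posIndex_le hW.orthogonal hVW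
  have h3 := posIndex_add_posIndex_orthogonal_le L (V ⊔ W)
  have h4 := hV.posIndex_add_posIndex_orthogonal
  have h5 := hW.posIndex_add_posIndex_orthogonal
  rw [finrank_sup_of_isOrtho hVW] at h3
  omega

theorem norm_sub_starProjection_le {V W : Submodule ℂ H} [V.HasOrthogonalProjection]
    [W.HasOrthogonalProjection] {u : H} (hu : u ∈ V) :
    ‖u - W.starProjection u‖ ≤ ‖V.starProjection - W.starProjection‖ * ‖u‖ := by
  have := ContinuousLinearMap.le_opNorm (V.starProjection - W.starProjection) u
  rwa [sub_apply, Submodule.starProjection_eq_self_iff.2 hu] at this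

/-- A nonzero `u ∈ V` satisfies `‖u - P_W u‖ < ‖u‖`, so `P_W` is injective on `V`. -/
theorem finrank_map_starProjection {V W : Submodule ℂ H} [V.HasOrthogonalProjection]
    [W.HasOrthogonalProjection] (h : ‖V.starProjection - W.starProjection‖ < 1)
    {P : Submodule ℂ H} (hP : P ≤ V) :
    Module.finrank ℂ (P.map (W.starProjection : H →ₗ[ℂ] H)) = Module.finrank ℂ P := by
  let f : P →ₗ[ℂ] H := (W.starProjection : H →ₗ[ℂ] H) ∘ₗ P.subtype
  have hf : Function.Injective f := by
    rw [← LinearMap.ker_eq_bot, LinearMap.ker_eq_bot']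
    intro u hu
    have h1 := norm_sub_starProjection_le (W := W) (hP u.2)
    have h2 : W.starProjection (u : H) = 0 := hu
    rw [h2, sub_zero] at h1
    by_contra h0
    have h3 : 0 < ‖(u : H)‖ := norm_pos_iff.2 fun hh => h0 (Subtype.ext hh)
    nlinarith
  have h1 := LinearMap.finrank_range_of_inj hf
  rwa [LinearMap.range_comp, Submodule.range_subtype] at h1

theorem map_starProjection_le (W P : Submodule ℂ H) [W.HasOrthogonalProjection] :
    P.map (W.starProjection : H →ₗ[ℂ] H) ≤ W := by
  rintro _ ⟨u, -, rfl⟩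
  exact W.starProjection_apply_mem u

theorem finrank_le_of_norm_starProjection_sub_lt {V W : Submodule ℂ H} [V.HasOrthogonalProjection]
    [W.HasOrthogonalProjection] [FiniteDimensional ℂ W]
    (h : ‖V.starProjection - W.starProjection‖ < 1) :
    Module.finrank ℂ V ≤ Module.finrank ℂ W := by
  rw [← finrank_map_starProjection h le_rfl]
  exact Submodule.finrank_mono (map_starProjection_le W V)

theorem finrank_eq_of_norm_starProjection_sub_lt {V W : Submodule ℂ H} [V.HasOrthogonalProjection]
    [W.HasOrthogonalProjection] [FiniteDimensional ℂ V] [FiniteDimensional ℂ W]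
    (h : ‖V.starProjection - W.starProjection‖ < 1) :
    Module.finrank ℂ V = Module.finrank ℂ W :=
  le_antisymm (finrank_le_of_norm_starProjection_sub_lt h)
    (finrank_le_of_norm_starProjection_sub_lt (norm_sub_rev V.starProjection _ ▸ h))

/-- Projecting a maximal positive subspace of `V` to `W` keeps its dimension and changes the form by
at most `1/4 · 2 ‖u‖²`, exactly what the gap 1/2 absorbs. -/
theorem AlmostCommutes.posIndex_le {V W : Submodule ℂ H} [V.HasOrthogonalProjection]
    [W.HasOrthogonalProjection] [FiniteDimensional ℂ V] [FiniteDimensional ℂ W]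
    (hV : AlmostCommutes L V) (h : ‖V.starProjection - W.starProjection‖ < 1 / 4) :
    posIndex L V ≤ posIndex L W := by
  obtain ⟨P, hPV, hPd, hP⟩ := exists_finrank_eq_posIndex_of_almostCommutes hV
  rw [← hPd, ← finrank_map_starProjection (h.trans (by norm_num)) hPV]
  refine finrank_le_posIndex L (map_starProjection_le W P) ?_
  rintro _ ⟨u, hu, rfl⟩ h0
  have hu0 : u ≠ 0 := fun hh => h0 (by simp [hh])
  have h1 := hP u hu hu0
  have h2 := norm_sub_starProjection_le (W := W) (hPV hu)
  have h3 := (abs_le.1 (abs_form_sub_le L u (W.starProjection u))).2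
  have h4 := W.norm_starProjection_apply_le u
  have h5 : ‖u - W.starProjection u‖ ≤ 1 / 4 * ‖u‖ :=
    h2.trans (mul_le_mul_of_nonneg_right h.le (norm_nonneg u))
  have h6 : ‖u - W.starProjection u‖ * (‖u‖ + ‖W.starProjection u‖) ≤
      1 / 4 * ‖u‖ * (‖u‖ + ‖u‖) := by gcongr
  change 0 < form L (W.starProjection u)
  nlinarith

theorem posIndex_eq_of_norm_starProjection_sub_lt {V W : Submodule ℂ H}
    [V.HasOrthogonalProjection] [W.HasOrthogonalProjection] [FiniteDimensional ℂ V]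
    [FiniteDimensional ℂ W] (hV : AlmostCommutes L V) (hW : AlmostCommutes L W)
    (h : ‖V.starProjection - W.starProjection‖ < 1 / 4) : posIndex L V = posIndex L W :=
  le_antisymm (hV.posIndex_le h) (hW.posIndex_le (norm_sub_rev V.starProjection _ ▸ h))

end Index

/-! ### Resolvents, spectrum and eigenspaces of unbounded operators -/

section Operators

variable {H : Type*} [NormedAddCommGroup H] [InnerProductSpace ℂ H]
variable {B : H →ₗ.[ℂ] H}

theorem IsResolventAt.mem_domain {z : ℂ} {R : H →L[ℂ] H} (h : IsResolventAt B z R) (u : H) :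
    R u ∈ B.domain := (h.1 u).1

theorem IsResolventAt.map_apply {z : ℂ} {R : H →L[ℂ] H} (h : IsResolventAt B z R) (u : H) :
    B ⟨R u, h.mem_domain u⟩ = z • R u - u := by
  obtain ⟨_, h1⟩ := h.1 u
  rw [sub_eq_iff_eq_add] at h1
  rw [h1, add_sub_cancel_left]

theorem IsResolventAt.comp_eq {z w : ℂ} {R R' : H →L[ℂ] H} (h : IsResolventAt B z R)
    (h' : IsResolventAt B w R') : R' * (1 + (w - z) • R) = R := by
  ext u
  have h1 := h'.2 ⟨R u, h.mem_domain u⟩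
  rw [h.map_apply] at h1
  simp only [mul_apply_eq_comp, add_apply, one_apply_eq_self, smul_apply]
  refine Eq.trans (congrArg R' ?_) h1
  simp only [sub_smul]
  abel

theorem IsResolventAt.isUnit {z w : ℂ} {R R' : H →L[ℂ] H} (h : IsResolventAt B z R)
    (h' : IsResolventAt B w R') : IsUnit (1 + (w - z) • R) := by
  have key : ∀ {z w : ℂ} {R R' : H →L[ℂ] H}, IsResolventAt B z R → IsResolventAt B w R' →
      (1 + (z - w) • R') * (1 + (w - z) • R) = 1 := by
    intro z w R R' h h'
    rw [add_mul, one_mul, smul_mul_assoc, h.comp_eq h', add_assoc, ← add_smul]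
    simp
  exact ⟨⟨_, _, key h' h, key h h'⟩, rfl⟩

/-- On the domain `w - B = (1 + (w - z) R)(z - B)`. Thus one resolvent turns questions about the
spectrum of `B` into invertibility of bounded operators. -/
theorem IsResolventAt.mul_inverse {z w : ℂ} {R : H →L[ℂ] H} (h : IsResolventAt B z R)
    (hu : IsUnit (1 + (w - z) • R)) :
    IsResolventAt B w (R * Ring.inverse (1 + (w - z) • R)) := by
  set X := 1 + (w - z) • R with hX
  have h1 : ∀ u, X (Ring.inverse X u) = u := fun u => by
    rw [← mul_apply_eq_comp, Ring.mul_inverse_cancel X hu, one_apply_eq_self]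
  have h2 : ∀ u, Ring.inverse X (X u) = u := fun u => by
    rw [← mul_apply_eq_comp, Ring.inverse_mul_cancel X hu, one_apply_eq_self]
  have h3 : ∀ y, w • R y - (z • R y - y) = X y := fun y => by
    rw [hX, add_apply, one_apply_eq_self, smul_apply, sub_smul]
    abel
  refine ⟨fun u => ⟨h.mem_domain _, ?_⟩, fun v => ?_⟩
  · simp only [mul_apply_eq_comp]
    rw [h.map_apply, h3, h1]
  · have h4 : w • (v : H) - B v = X (z • (v : H) - B v) := by
      rw [← h3, h.2 v]
      abel
    rw [h4, mul_apply_eq_comp, h2, h.2 v]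

theorem IsResolventAt.notMem_spec_iff {z : ℂ} {R : H →L[ℂ] H} (h : IsResolventAt B z R) (c : ℝ) :
    c ∉ spec B ↔ IsUnit (1 + ((c : ℂ) - z) • R) := by
  rw [spec, Set.mem_ofPred_eq, not_not]
  exact ⟨fun ⟨_, h'⟩ => h.isUnit h', fun hu => ⟨_, h.mul_inverse hu⟩⟩

theorem eigenspace_eq_bot {c : ℝ} (hc : c ∉ spec B) : eigenspace B c = ⊥ := by
  rw [spec, Set.mem_ofPred_eq, not_not] at hc
  obtain ⟨R, hR⟩ := hc
  refine (Submodule.eq_bot_iff _).2 ?_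
  rintro u ⟨hu, hu'⟩
  have := hR.2 ⟨u, hu⟩
  rw [hu', sub_self, map_zero] at this
  exact this.symm

theorem IsResolventAt.mem_eigenspace_iff {p d : ℝ} {S : H →L[ℂ] H} (h : IsResolventAt B p S)
    (hd : d ≠ p) {u : H} : u ∈ eigenspace B d ↔ S u = (((p - d)⁻¹ : ℝ) : ℂ) • u := by
  have h0 : ((p : ℂ) - d) ≠ 0 := by
    rw [← Complex.ofReal_sub, Complex.ofReal_ne_zero]
    exact sub_ne_zero.2 hd.symm
  constructor
  · rintro ⟨hu, hu'⟩
    have h1 := h.2 ⟨u, hu⟩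
    rw [hu', ← sub_smul, map_smul] at h1
    push_cast
    rw [eq_inv_smul_iff₀ h0, h1]
  · intro hu
    push_cast at hu
    rw [eq_inv_smul_iff₀ h0] at hu
    have hm : u ∈ B.domain := hu ▸ B.domain.smul_mem _ (h.mem_domain u)
    have h1 : (⟨u, hm⟩ : B.domain) = ((p : ℂ) - d) • ⟨S u, h.mem_domain u⟩ := Subtype.ext hu.symm
    refine ⟨hm, ?_⟩
    rw [h1, B.map_smul, h.map_apply, smul_sub, smul_comm, hu, sub_smul]
    abel

theorem eigenspace_le_eigenSpan {J : Set ℝ} {c : ℝ} (hc : c ∈ J) :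
    eigenspace B c ≤ eigenSpan B J := le_iSup₂_of_le c hc le_rfl

theorem eigenSpan_le {J : Set ℝ} {V : Submodule ℂ H} (h : ∀ c ∈ J, eigenspace B c ≤ V) :
    eigenSpan B J ≤ V := iSup₂_le h

theorem eigenSpan_mono {J K : Set ℝ} (h : J ⊆ K) : eigenSpan B J ≤ eigenSpan B K :=
  eigenSpan_le fun _ hc => eigenspace_le_eigenSpan (h hc)

theorem eigenSpan_eq_bot {J : Set ℝ} (h : ∀ c ∈ J, c ∉ spec B) : eigenSpan B J = ⊥ :=
  eq_bot_iff.2 (eigenSpan_le fun c hc => (eigenspace_eq_bot (h c hc)).le)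

theorem eigenSpan_Ioo_eq_sup {p q r : ℝ} (hpq : p ≤ q) (hqr : q ≤ r) (hq : q ∉ spec B) :
    eigenSpan B (Set.Ioo p r) = eigenSpan B (Set.Ioo p q) ⊔ eigenSpan B (Set.Ioo q r) := by
  refine le_antisymm (eigenSpan_le fun c hc => ?_) (sup_le (eigenSpan_mono ?_) (eigenSpan_mono ?_))
  · rcases lt_trichotomy c q with h | rfl | h
    · exact le_sup_of_le_left (eigenspace_le_eigenSpan ⟨hc.1, h⟩)
    · rw [eigenspace_eq_bot hq]
      exact bot_le
    · exact le_sup_of_le_right (eigenspace_le_eigenSpan ⟨h, hc.2⟩)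
  · exact Set.Ioo_subset_Ioo_right hqr
  · exact Set.Ioo_subset_Ioo_left hpq

theorem finiteDimensional_eigenSpan {J : Set ℝ} (hf : (spec B ∩ J).Finite)
    (hd : HasDiscreteSpectrumOn B J) : FiniteDimensional ℂ (eigenSpan B J) := by
  have h1 : eigenSpan B J = ⨆ c : (spec B ∩ J : Set ℝ), eigenspace B (c : ℝ) := by
    refine le_antisymm (eigenSpan_le fun c hc => ?_) (iSup_le fun c => ?_)
    · by_cases hs : c ∈ spec B
      · exact le_iSup (fun c : (spec B ∩ J : Set ℝ) => eigenspace B (c : ℝ)) ⟨c, hs, hc⟩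
      · rw [eigenspace_eq_bot hs]
        exact bot_le
    · exact eigenspace_le_eigenSpan c.2.2
  have := hf.to_subtype
  have : ∀ c : (spec B ∩ J : Set ℝ), FiniteDimensional ℂ (eigenspace B (c : ℝ)) :=
    fun c => (hd c c.2).2.2
  rw [h1]
  infer_instance

/-- A compact set all of whose points are isolated is finite. -/
theorem finite_spec_inter (hc : IsClosed (spec B)) {J K : Set ℝ} (hK : IsCompact K) (hKJ : K ⊆ J)
    (hd : HasDiscreteSpectrumOn B J) : (spec B ∩ K).Finite := by
  refine (hK.inter_left hc).finite (isDiscrete_iff_forall_mem_exists_isOpen.2 ?_)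
  rintro c ⟨hcs, hcK⟩
  obtain ⟨⟨ε, hε, h⟩, -⟩ := hd c ⟨hcs, hKJ hcK⟩
  refine ⟨Metric.ball c ε, Metric.isOpen_ball, ?_⟩
  ext d
  simp only [Set.mem_inter_iff, Metric.mem_ball, Real.dist_eq, Set.mem_singleton_iff]
  exact ⟨fun hh => h d hh.2.1 hh.1, by rintro rfl; exact ⟨by simpa using hε, hcs, hcK⟩⟩

theorem IsResolventAt.mem_spectrum_iff {p c : ℝ} {S : H →L[ℂ] H} (h : IsResolventAt B p S)
    (hc : c ≠ 0) : c ∈ spectrum ℝ S ↔ p - c⁻¹ ∈ spec B := by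
  rw [spectrum.mem_iff, ← not_iff_not, not_not, h.notMem_spec_iff]
  have h1 : algebraMap ℝ (H →L[ℂ] H) c - S =
      Units.mk0 c hc • (1 + (((p - c⁻¹ : ℝ) : ℂ) - p) • S) := by
    have h2 : (((p - c⁻¹ : ℝ) : ℂ) - p) • S = (-c⁻¹) • S := by
      rw [← Complex.ofReal_sub, sub_sub_cancel_left]
      rfl
    rw [h2, Units.smul_def, Units.val_mk0, smul_add, smul_smul, mul_neg, mul_inv_cancel₀ hc,
      neg_one_smul, Algebra.algebraMap_eq_smul_one, sub_eq_add_neg]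
  rw [h1, isUnit_smul_iff]

section Complete

variable [CompleteSpace H]

theorem inner_map_eq_inner_map (hB : IsSelfAdjoint B) (u v : B.domain) :
    inner ℂ (B u) (v : H) = inner ℂ (u : H) (B v) := by
  have h := LinearPMap.adjoint_isFormalAdjoint hB.dense_domain
  rw [LinearPMap.isSelfAdjoint_def.1 hB] at h
  exact h u v

theorem isOrtho_eigenspace (hB : IsSelfAdjoint B) {c d : ℝ} (hcd : c ≠ d) :
    eigenspace B c ⟂ eigenspace B d := by
  rw [Submodule.isOrtho_iff_inner_eq]
  rintro u ⟨hu, hu'⟩ v ⟨hv, hv'⟩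
  have h := inner_map_eq_inner_map hB ⟨u, hu⟩ ⟨v, hv⟩
  rw [hu', hv', inner_smul_left, inner_smul_right, Complex.conj_ofReal] at h
  by_contra h0
  exact hcd (Complex.ofReal_injective (mul_right_cancel₀ h0 h))

theorem isOrtho_eigenSpan (hB : IsSelfAdjoint B) {J K : Set ℝ} (h : Disjoint J K) :
    eigenSpan B J ⟂ eigenSpan B K := by
  simp only [eigenSpan, Submodule.isOrtho_iSup_left, Submodule.isOrtho_iSup_right]
  exact fun c hc d hd => isOrtho_eigenspace hB (h.ne_of_mem hd hc)

theorem IsResolventAt.isSelfAdjoint (hB : IsSelfAdjoint B) {p : ℝ} {S : H →L[ℂ] H}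
    (h : IsResolventAt B p S) : IsSelfAdjoint S := by
  rw [ContinuousLinearMap.isSelfAdjoint_iff_isSymmetric]
  intro u v
  change inner ℂ (S u) v = inner ℂ u (S v)
  have h1 := inner_map_eq_inner_map hB ⟨S u, h.mem_domain u⟩ ⟨S v, h.mem_domain v⟩
  rw [h.map_apply, h.map_apply] at h1
  simp only [inner_sub_left, inner_sub_right, inner_smul_left, inner_smul_right,
    Complex.conj_ofReal] at h1
  exact (sub_right_injective h1).symm

theorem IsResolventAt.isOpen_compl_spec {z : ℂ} {R : H →L[ℂ] H} (h : IsResolventAt B z R) :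
    IsOpen (spec B)ᶜ := by
  have h1 : (spec B)ᶜ = (fun c : ℝ => 1 + ((c : ℂ) - z) • R) ⁻¹' {x | IsUnit x} := by
    ext c
    exact h.notMem_spec_iff c
  rw [h1]
  exact Units.isOpen.preimage (by fun_prop)

end Complete

end Operators

/-! ### Spectral projections by functional calculus of a real resolvent -/

/-- The indicator function of the half-line `(-∞, a)`. -/
noncomputable def belowInd (a x : ℝ) : ℝ := if x < a then 1 else 0

theorem continuousOn_belowInd {a : ℝ} {s : Set ℝ} (h : a ∉ s) : ContinuousOn (belowInd a) s := by
  intro x hx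
  refine ContinuousAt.continuousWithinAt ?_
  rcases lt_or_gt_of_ne (ne_of_mem_of_not_mem hx h) with hxa | hxa
  · refine (continuousAt_const (y := (1 : ℝ))).congr ?_
    filter_upwards [Iio_mem_nhds hxa] with y hy
    exact (if_pos hy).symm
  · refine (continuousAt_const (y := (0 : ℝ))).congr ?_
    filter_upwards [Ioi_mem_nhds hxa] with y hy
    exact (if_neg (not_lt.2 (le_of_lt hy))).symm

section

variable {H : Type*} [NormedAddCommGroup H] [InnerProductSpace ℂ H] {B : H →ₗ.[ℂ] H}
  {S : H →L[ℂ] H}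

theorem IsResolventAt.inv_notMem_spectrum {p q : ℝ} (h : IsResolventAt B p S) (hpq : p ≠ q)
    (hq : q ∉ spec B) : (p - q)⁻¹ ∉ spectrum ℝ S := by
  rwa [h.mem_spectrum_iff (inv_ne_zero (sub_ne_zero.2 hpq)), inv_inv, sub_sub_cancel]

/-- Under `d ↦ (p - d)⁻¹` the window `(p, q)` becomes the half-line below `(p - q)⁻¹`. With the
resolvent taken at the endpoint `p`, a single cut therefore suffices. -/
theorem sub_inv_mem_Ioo {p q c : ℝ} (hpq : p < q) (hc : c < (p - q)⁻¹) :
    c < 0 ∧ p - c⁻¹ ∈ Set.Ioo p q := by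
  have h0 : (p - q)⁻¹ < 0 := inv_lt_zero.2 (sub_neg.2 hpq)
  have hc0 := hc.trans h0
  have h1 : c⁻¹ < 0 := inv_lt_zero.2 hc0
  have h2 : p - q < c⁻¹ := by
    rw [lt_inv_of_neg (sub_neg.2 hpq) hc0]
    exact hc
  exact ⟨hc0, by linarith, by linarith⟩

theorem IsResolventAt.finite_spectrum_inter {p q : ℝ} (h : IsResolventAt B p S) (hpq : p < q)
    (hf : (spec B ∩ Set.Ioo p q).Finite) : (spectrum ℝ S ∩ Set.Iio (p - q)⁻¹).Finite := by
  refine Set.Finite.of_injOn (f := fun c => p - c⁻¹) ?_ ?_ hf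
  · rintro c ⟨hcS, hc⟩
    obtain ⟨hc0, hc1⟩ := sub_inv_mem_Ioo hpq hc
    exact ⟨(h.mem_spectrum_iff hc0.ne).1 hcS, hc1⟩
  · intro c _ d _ hcd
    exact inv_injective (sub_right_injective hcd)

end

section

variable {H : Type*} [NormedAddCommGroup H] [InnerProductSpace ℂ H] [CompleteSpace H]

/-- The indicator is discontinuous only at `a`. By upper hemicontinuity, the spectra of nearby
operators stay in a compact set missing `a`, where the functional calculus is continuous in the
operator. -/
theorem continuousAt_cfc_belowInd {X : Type*} [TopologicalSpace X] {S : X → H →L[ℂ] H} {x₀ : X}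
    (hS : ContinuousAt S x₀) (hsa : ∀ᶠ x in 𝓝 x₀, IsSelfAdjoint (S x)) {a : ℝ}
    (ha : a ∉ spectrum ℝ (S x₀)) : ContinuousAt (fun x => cfc (belowInd a) (S x)) x₀ := by
  have h1 : ({a}ᶜ : Set ℝ) ∈ 𝓝ˢ (spectrum ℝ (S x₀)) :=
    isOpen_compl_singleton.mem_nhdsSet.2 fun x hx => ne_of_mem_of_not_mem hx ha
  obtain ⟨k, ⟨hkS, hk⟩, hka⟩ :=
    (spectrum.isCompact (𝕜 := ℝ) (S x₀)).nhdsSet_basis_isCompact.mem_iff.1 h1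
  have h2 := (upperHemicontinuous_spectrum ℝ (H →L[ℂ] H)).isOpen k
  refine ContinuousAt.cfc hk (belowInd a) hS ?_ hsa
    (continuousOn_belowInd fun hak => hka hak rfl)
  filter_upwards [hS (h2.mem_nhds hkS)] with x hx
  exact subset_of_mem_nhdsSet hx

variable {S : H →L[ℂ] H}

theorem cfc_belowInd_mul_self {a : ℝ} (ha : a ∉ spectrum ℝ S) :
    cfc (belowInd a) S * cfc (belowInd a) S = cfc (belowInd a) S := by
  have hc := continuousOn_belowInd ha
  rw [← cfc_mul _ _ S]
  refine cfc_congr fun x _ => ?_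
  simp [belowInd]

theorem cfc_belowInd_apply_eq_self (hS : IsSelfAdjoint S) {a c : ℝ} (ha : a ∉ spectrum ℝ S)
    (hca : c < a) {u : H} (hu : S u = (c : ℂ) • u) : cfc (belowInd a) S u = u := by
  have hc := continuousOn_belowInd ha
  -- On the spectrum `g x · (x - c) = 1 - belowInd a x`, so `1 - E` factors through `S - c`, which
  -- kills `u`. The `max` keeps the inverted factor positive everywhere.
  let g : ℝ → ℝ := fun x => (1 - belowInd a x) * (max (x - c) (a - c))⁻¹
  have hg : ContinuousOn g (spectrum ℝ S) := by
    refine (continuousOn_const.sub hc).mul (ContinuousOn.inv₀ (by fun_prop) fun x _ => ?_)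
    exact (lt_of_lt_of_le (sub_pos.2 hca) (le_max_right _ _)).ne'
  have h1 : cfc g S * (S - algebraMap ℝ _ c) = 1 - cfc (belowInd a) S := by
    have h2 : S - algebraMap ℝ _ c = cfc (fun x : ℝ => x - c) S := by
      rw [cfc_sub _ _ S, cfc_id' ℝ S, cfc_const c S]
    rw [h2, ← cfc_mul _ _ S, ← cfc_one ℝ S, ← cfc_sub _ _ S]
    refine cfc_congr fun x _ => ?_
    by_cases hx : x < a
    · simp [g, belowInd, hx]
    · have h3 : a - c ≤ x - c := by linarith [not_lt.1 hx]
      have h4 : x - c ≠ 0 := ((sub_pos.2 hca).trans_le h3).ne'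
      simp [g, belowInd, hx, max_eq_left h3, inv_mul_cancel₀ h4]
  have h2 := congrArg (fun T : H →L[ℂ] H => T u) h1
  simp only [mul_apply_eq_comp, sub_apply, one_apply_eq_self, Algebra.algebraMap_eq_smul_one,
    smul_apply, hu] at h2
  have h3 : (c : ℂ) • u - c • u = 0 := sub_self _
  rw [h3, map_zero] at h2
  exact (sub_eq_zero.1 h2.symm).symm

/-- The finitely many spectral points below `a` are isolated in the spectrum, so their indicators
are continuous there and `F c` is the spectral projection at `c`. -/
theorem exists_eq_sum_cfc_belowInd (hS : IsSelfAdjoint S) {a : ℝ}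
    (hf : (spectrum ℝ S ∩ Set.Iio a).Finite) :
    ∃ F : ℝ → H →L[ℂ] H, (∀ c ∈ hf.toFinset, S * F c = (c : ℂ) • F c) ∧
      cfc (belowInd a) S = ∑ c ∈ hf.toFinset, F c := by
  have hcont : ∀ c ∈ hf.toFinset,
      ContinuousOn (fun x : ℝ => if x = c then (1 : ℝ) else 0) (spectrum ℝ S) := by
    intro c hc
    rw [Set.Finite.mem_toFinset] at hc
    intro x hx
    rcases eq_or_ne x c with rfl | hxc
    · have hcl : IsClosed (Set.Ici a ∪ ((spectrum ℝ S ∩ Set.Iio a) \ {x})) :=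
        isClosed_Ici.union (hf.subset Set.sdiff_subset).isClosed
      have hx' : x ∈ (Set.Ici a ∪ ((spectrum ℝ S ∩ Set.Iio a) \ {x}))ᶜ := by
        simpa using hc.2
      refine (continuousWithinAt_const (b := (1 : ℝ))).congr_of_eventuallyEq ?_ (if_pos rfl)
      filter_upwards [mem_nhdsWithin_of_mem_nhds (hcl.isOpen_compl.mem_nhds hx'),
        self_mem_nhdsWithin] with y hy hyS
      refine if_pos (by_contra fun hyx => hy ?_)
      rcases lt_or_ge y a with h | h
      · exact Or.inr ⟨⟨hyS, h⟩, hyx⟩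
      · exact Or.inl h
    · refine (continuousAt_const (y := (0 : ℝ))).congr ?_ |>.continuousWithinAt
      filter_upwards [isOpen_ne.mem_nhds hxc] with y hy
      exact (if_neg hy).symm
  refine ⟨fun c => cfc (fun x : ℝ => if x = c then (1 : ℝ) else 0) S, fun c hc => ?_, ?_⟩
  · have := hcont c hc
    conv_lhs => enter [1]; rw [← cfc_id' ℝ S]
    rw [← cfc_mul _ _ S]
    have h1 : (c : ℂ) • cfc (fun x : ℝ => if x = c then (1 : ℝ) else 0) S =
      cfc (fun x : ℝ => c * if x = c then (1 : ℝ) else 0) S := by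
      rw [cfc_const_mul _ _ S]; rfl
    rw [h1]
    refine cfc_congr fun x _ => ?_
    by_cases h : x = c <;> simp [h]
  · rw [← cfc_sum _ _ hf.toFinset hcont]
    refine cfc_congr fun x hx => ?_
    simp [belowInd, hx]

variable {B : H →ₗ.[ℂ] H}

/-- The functional calculus gives a symmetric idempotent whose range lies in the eigenspan and which
fixes every eigenvector in it; this characterises the orthogonal projection. -/
theorem IsResolventAt.starProjection_eigenSpan (hB : IsSelfAdjoint B) {p q : ℝ}
    (h : IsResolventAt B p S) (hpq : p < q) (hq : q ∉ spec B)
    (hf : (spec B ∩ Set.Ioo p q).Finite) [(eigenSpan B (Set.Ioo p q)).HasOrthogonalProjection] :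
    (eigenSpan B (Set.Ioo p q)).starProjection = cfc (belowInd (p - q)⁻¹) S := by
  have hS := h.isSelfAdjoint hB
  have ha := h.inv_notMem_spectrum hpq.ne hq
  set E := cfc (belowInd (p - q)⁻¹) S with hE
  have hEsa : E.IsSymmetric := (IsSelfAdjoint.cfc (f := belowInd (p - q)⁻¹) (a := S)).isSymmetric
  have hEE : ∀ u, E (E u) = E u := fun u => by
    rw [← mul_apply_eq_comp, cfc_belowInd_mul_self ha]
  have hmem : ∀ u, E u ∈ eigenSpan B (Set.Ioo p q) := by
    intro u
    obtain ⟨F, hF, hsum⟩ := exists_eq_sum_cfc_belowInd hS (h.finite_spectrum_inter hpq hf)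
    rw [hE, hsum, sum_apply]
    refine Submodule.sum_mem _ fun c hc => ?_
    have h1 := congrArg (fun T : H →L[ℂ] H => T u) (hF c hc)
    rw [Set.Finite.mem_toFinset] at hc
    obtain ⟨hc0, hc1⟩ := sub_inv_mem_Ioo hpq hc.2
    refine eigenspace_le_eigenSpan hc1 ((h.mem_eigenspace_iff hc1.1.ne').2 ?_)
    rw [sub_sub_cancel, inv_inv]
    exact h1
  have hfix : ∀ w ∈ eigenSpan B (Set.Ioo p q), E w = w := by
    have hle : eigenSpan B (Set.Ioo p q) ≤ LinearMap.eqLocus (E : H →ₗ[ℂ] H) LinearMap.id := by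
      refine eigenSpan_le fun d hd u hu => ?_
      have h1 := (h.mem_eigenspace_iff hd.1.ne').1 hu
      refine cfc_belowInd_apply_eq_self hS ha ?_ h1
      rw [inv_lt_inv_of_neg (by linarith [hd.1]) (by linarith)]
      linarith [hd.2]
    exact fun w hw => hle hw
  ext u
  refine Submodule.eq_starProjection_of_mem_of_inner_eq_zero (hmem u) fun w hw => ?_
  have h1 : inner ℂ (E (u - E u)) w = inner ℂ (u - E u) (E w) := hEsa (u - E u) w
  rw [← hfix w hw, ← h1, map_sub, hEE, sub_self, inner_zero_left]

theorem eigenProj_eq (J : Set ℝ) [FiniteDimensional ℂ (eigenSpan B J)] :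
    eigenProj B J = (eigenSpan B J).starProjection := by
  have h : (eigenSpan B J).topologicalClosure = eigenSpan B J :=
    (Submodule.closed_of_finiteDimensional _).submodule_topologicalClosure_eq
  unfold eigenProj
  congr!

/-! ### Norm continuity of spectral projections in the parameter -/

section Family

variable {X : Type*} [TopologicalSpace X] {B : X → H →ₗ.[ℂ] H} {δ : ℝ}

theorem IsRegularWith.isClosed_spec (h : IsRegularWith B δ) (x : X) : IsClosed (spec (B x)) := by
  obtain ⟨R, -, hR⟩ := h.continuous_resolvent
  exact isOpen_compl_iff.1 (hR x).isOpen_compl_spec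

theorem IsRegularWith.isOpen_notMem_spec (h : IsRegularWith B δ) (p : ℝ) :
    IsOpen {x | p ∉ spec (B x)} := by
  obtain ⟨R, hRc, hR⟩ := h.continuous_resolvent
  simp only [(hR _).notMem_spec_iff]
  exact Units.isOpen.preimage (by fun_prop : Continuous fun x => 1 + ((p : ℂ) - Complex.I) • R x)

theorem IsRegularWith.exists_continuousAt_resolvent (h : IsRegularWith B δ) {p : ℝ} {x₀ : X}
    (hp : p ∉ spec (B x₀)) : ∃ S : X → H →L[ℂ] H, ContinuousAt S x₀ ∧
      ∀ x, p ∉ spec (B x) → IsResolventAt (B x) p (S x) := by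
  obtain ⟨R, hRc, hR⟩ := h.continuous_resolvent
  refine ⟨fun x => R x * Ring.inverse (1 + ((p : ℂ) - Complex.I) • R x), ?_, fun x hx => ?_⟩
  · have hu := ((hR x₀).notMem_spec_iff p).1 hp
    have h1 : ContinuousAt Ring.inverse (1 + ((p : ℂ) - Complex.I) • R x₀) :=
      hu.unit_spec ▸ NormedRing.inverse_continuousAt hu.unit
    exact hRc.continuousAt.mul
      (ContinuousAt.comp (f := fun x => 1 + ((p : ℂ) - Complex.I) • R x) h1 (by fun_prop))
  · exact (hR x).mul_inverse (((hR x).notMem_spec_iff p).1 hx)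

theorem IsRegularWith.finite_spec_inter_Icc (h : IsRegularWith B δ) {p q : ℝ}
    (hp : p ∈ Set.Ioo (-δ) δ) (hq : q ∈ Set.Ioo (-δ) δ) (x : X) :
    (spec (B x) ∩ Set.Icc p q).Finite :=
  finite_spec_inter (h.isClosed_spec x) isCompact_Icc (Set.Icc_subset_Ioo hp.1 hq.2) (h.discrete x)

theorem IsRegularWith.finite_spec_inter_Ioo (h : IsRegularWith B δ) {p q : ℝ}
    (hp : p ∈ Set.Ioo (-δ) δ) (hq : q ∈ Set.Ioo (-δ) δ) (x : X) :
    (spec (B x) ∩ Set.Ioo p q).Finite :=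
  (h.finite_spec_inter_Icc hp hq x).subset (Set.inter_subset_inter_right _ Set.Ioo_subset_Icc_self)

theorem IsRegularWith.finiteDimensional_eigenSpan (h : IsRegularWith B δ) {p q : ℝ}
    (hp : p ∈ Set.Ioo (-δ) δ) (hq : q ∈ Set.Ioo (-δ) δ) (x : X) :
    FiniteDimensional ℂ (eigenSpan (B x) (Set.Ioo p q)) :=
  PartialFlow.finiteDimensional_eigenSpan (h.finite_spec_inter_Ioo hp hq x)
    fun c hc => h.discrete x c ⟨hc.1, hp.1.trans hc.2.1, hc.2.2.trans hq.2⟩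

theorem IsRegularWith.continuousAt_eigenProj (h : IsRegularWith B δ)
    (hB : ∀ x, IsSelfAdjoint (B x)) {p q : ℝ} (hp : p ∈ Set.Ioo (-δ) δ) (hq : q ∈ Set.Ioo (-δ) δ)
    (hpq : p < q) {x₀ : X} (hpx : p ∉ spec (B x₀)) (hqx : q ∉ spec (B x₀)) :
    ContinuousAt (fun x => eigenProj (B x) (Set.Ioo p q)) x₀ := by
  obtain ⟨S, hSc, hS⟩ := h.exists_continuousAt_resolvent hpx
  have hpev := (h.isOpen_notMem_spec p).mem_nhds hpx
  have hqev := (h.isOpen_notMem_spec q).mem_nhds hqx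
  refine (continuousAt_cfc_belowInd hSc ?_
    ((hS x₀ hpx).inv_notMem_spectrum hpq.ne hqx)).congr ?_
  · filter_upwards [hpev] with x hx
    exact (hS x hx).isSelfAdjoint (hB x)
  · filter_upwards [hpev, hqev] with x hx hx'
    have := h.finiteDimensional_eigenSpan hp hq x
    rw [eigenProj_eq, (hS x hx).starProjection_eigenSpan (hB x) hpq hx'
      (h.finite_spec_inter_Ioo hp hq x)]

end Family

end

/-! ### Gluing local primitives to a global potential -/

section Potential

variable {X : Type*} [TopologicalSpace X]

/-- `F` differs from each of the locally defined functions `x ↦ N x p`, `x ∈ U p`, by a locally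
constant function on `A`. -/
def IsPotentialOn (U : ℝ → Set X) (N : X → ℝ → ℤ) (F : X → ℤ) (A : Set X) : Prop :=
  ∀ p, ∀ x ∈ A, x ∈ U p → ∀ᶠ y in 𝓝[A] x, F y - N y p = F x - N x p

variable {U : ℝ → Set X} {N : X → ℝ → ℤ} {F G : X → ℤ} {A C : Set X}

theorem IsPotentialOn.mono (h : IsPotentialOn U N F A) (hCA : C ⊆ A) : IsPotentialOn U N F C :=
  fun p x hx hxp => (h p x (hCA hx) hxp).filter_mono (nhdsWithin_mono x hCA)

theorem IsPotentialOn.eq_of_isPreconnected {p : ℝ} (h : IsPotentialOn U N F A) (hA : A ⊆ U p)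
    (hc : IsPreconnected A) {x y : X} (hx : x ∈ A) (hy : y ∈ A) : F x - N x p = F y - N y p := by
  refine hc.constant (f := fun x => F x - N x p) (fun z hz => ?_) hx hy
  refine tendsto_nhds_of_eventually_eq ?_
  exact h p z hz (hA hz)

theorem IsPotentialOn.sub_eq_of_isPreconnected (hU : ∀ x, ∃ p, x ∈ U p)
    (hF : IsPotentialOn U N F A) (hG : IsPotentialOn U N G A) (hc : IsPreconnected A) {x y : X}
    (hx : x ∈ A) (hy : y ∈ A) : F x - G x = F y - G y := by
  refine hc.constant (f := fun x => F x - G x) (fun z hz => ?_) hx hy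
  refine tendsto_nhds_of_eventually_eq ?_
  obtain ⟨p, hp⟩ := hU z
  filter_upwards [hF p z hz hp, hG p z hz hp] with y h1 h2
  omega

/-- On the connected overlap the two potentials differ by a constant; shifting `G` by it makes them
agree. -/
theorem IsPotentialOn.exists_union (hU : ∀ x, ∃ p, x ∈ U p) (hA : IsClosed A) (hC : IsClosed C)
    (hAC : IsPreconnected (A ∩ C)) (hne : (A ∩ C).Nonempty)
    (hF : IsPotentialOn U N F A) (hG : IsPotentialOn U N G C) :
    ∃ K : X → ℤ, IsPotentialOn U N K (A ∪ C) := by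
  classical
  obtain ⟨z, hz⟩ := hne
  let K : X → ℤ := fun x => if x ∈ A then F x else G x + (F z - G z)
  have hKA : ∀ x ∈ A, K x = F x := fun x hx => if_pos hx
  have hKC : ∀ x ∈ C, K x = G x + (F z - G z) := fun x hx => by
    by_cases hxA : x ∈ A
    · have := (hF.mono Set.inter_subset_left).sub_eq_of_isPreconnected hU
        (hG.mono Set.inter_subset_right) hAC ⟨hxA, hx⟩ hz
      rw [hKA x hxA]
      omega
    · exact if_neg hxA
  refine ⟨K, fun p x hx hxp => ?_⟩
  rw [nhdsWithin_union, eventually_sup]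
  constructor
  · by_cases hxA : x ∈ A
    · filter_upwards [hF p x hxA hxp, self_mem_nhdsWithin] with y hy hyA
      rw [hKA x hxA, hKA y hyA, hy]
    -- As `A` is closed, a point outside it has no nearby points of `A`, and the condition is
    -- vacuous.
    · rw [show 𝓝[A] x = ⊥ from notMem_closure_iff_nhdsWithin_eq_bot.1 (by rwa [hA.closure_eq])]
      exact eventually_bot
  · by_cases hxC : x ∈ C
    · filter_upwards [hG p x hxC hxp, self_mem_nhdsWithin] with y hy hyC
      rw [hKC x hxC, hKC y hyC]
      omega
    · rw [show 𝓝[C] x = ⊥ from notMem_closure_iff_nhdsWithin_eq_bot.1 (by rwa [hC.closure_eq])]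
      exact eventually_bot

theorem IsPotentialOn.comp {Y : Type*} [TopologicalSpace Y] (h : IsPotentialOn U N F Set.univ)
    {φ : Y → X} (hφ : Continuous φ) :
    IsPotentialOn (fun p => φ ⁻¹' U p) (fun y => N (φ y)) (F ∘ φ) Set.univ := by
  intro p y _ hy
  have := h p (φ y) (Set.mem_univ _) hy
  rw [nhdsWithin_univ] at this ⊢
  exact hφ.continuousAt.eventually this

theorem isPotentialOn_of_subset
    (hN : ∀ p q x, x ∈ U p → x ∈ U q → ∀ᶠ y in 𝓝 x, N y p - N y q = N x p - N x q)
    {p : ℝ} (hA : A ⊆ U p) : IsPotentialOn U N (fun x => N x p) A :=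
  fun q x hx hxq => (hN p q x (hA hx) hxq).filter_mono nhdsWithin_le_nhds

/-- A Lebesgue grid puts each cell inside a single `U p`, where `N · p` itself is a potential. Cells
are glued into rows and rows into the square; each overlap is a segment or a point, hence connected.
-/
theorem exists_isPotentialOn_unitSquare {U : ℝ → Set (unitInterval × unitInterval)}
    {N : unitInterval × unitInterval → ℝ → ℤ} (hUo : ∀ p, IsOpen (U p)) (hU : ∀ x, ∃ p, x ∈ U p)
    (hN : ∀ p q x, x ∈ U p → x ∈ U q → ∀ᶠ y in 𝓝 x, N y p - N y q = N x p - N x q) :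
    ∃ F, IsPotentialOn U N F Set.univ := by
  obtain ⟨t, t0, tmono, ⟨n, hn⟩, ht⟩ := exists_monotone_Icc_subset_open_cover_unitInterval_prod_self
    hUo (fun x _ => Set.mem_iUnion.2 (hU x))
  have hcell : ∀ n m : ℕ,
      ∃ F, IsPotentialOn U N F (Set.Icc (t n) (t (n + 1)) ×ˢ Set.Icc (t m) (t (m + 1))) := by
    intro n m
    obtain ⟨p, hp⟩ := ht n m
    exact ⟨_, isPotentialOn_of_subset hN hp⟩
  have hIcc : ∀ n, Set.Icc 0 (t n) ∪ Set.Icc (t n) (t (n + 1)) = Set.Icc 0 (t (n + 1)) :=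
    fun n => Set.Icc_union_Icc_eq_Icc unitInterval.nonneg' (tmono n.le_succ)
  have hInt : ∀ n, Set.Icc 0 (t n) ∩ Set.Icc (t n) (t (n + 1)) = {t n} := by
    intro n
    rw [Set.Icc_inter_Icc_eq_singleton unitInterval.nonneg' (tmono n.le_succ)]
  have hrow : ∀ m n : ℕ,
      ∃ F, IsPotentialOn U N F (Set.Icc 0 (t n) ×ˢ Set.Icc (t m) (t (m + 1))) := by
    intro m n
    induction n with
    | zero =>
      obtain ⟨F, hF⟩ := hcell 0 m
      refine ⟨F, hF.mono (Set.prod_mono_left ?_)⟩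
      rw [t0]
      exact Set.Icc_subset_Icc_right unitInterval.nonneg'
    | succ n ih =>
      obtain ⟨F, hF⟩ := ih
      obtain ⟨G, hG⟩ := hcell n m
      rw [← hIcc n, Set.union_prod]
      refine hF.exists_union hU (isClosed_Icc.prod isClosed_Icc) (isClosed_Icc.prod isClosed_Icc)
        ?_ ?_ hG
      · rw [← Set.inter_prod, hInt]
        exact isPreconnected_singleton.prod isPreconnected_Icc
      · rw [← Set.inter_prod, hInt]
        exact (Set.singleton_nonempty _).prod (Set.nonempty_Icc.2 (tmono m.le_succ))
  have hall : ∀ m, ∃ F, IsPotentialOn U N F (Set.Icc 0 1 ×ˢ Set.Icc 0 (t m)) := by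
    intro m
    induction m with
    | zero =>
      obtain ⟨F, hF⟩ := hrow 0 n
      rw [hn n le_rfl] at hF
      refine ⟨F, hF.mono (Set.prod_mono_right ?_)⟩
      rw [t0]
      exact Set.Icc_subset_Icc_right unitInterval.nonneg'
    | succ m ih =>
      obtain ⟨F, hF⟩ := ih
      obtain ⟨G, hG⟩ := hrow m n
      rw [hn n le_rfl] at hG
      rw [← hIcc m, Set.prod_union]
      refine hF.exists_union hU (isClosed_Icc.prod isClosed_Icc) (isClosed_Icc.prod isClosed_Icc)
        ?_ ?_ hG
      · rw [← Set.prod_inter, hInt]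
        exact isPreconnected_Icc.prod isPreconnected_singleton
      · rw [← Set.prod_inter, hInt]
        exact (Set.nonempty_Icc.2 zero_le_one).prod (Set.singleton_nonempty _)
  obtain ⟨F, hF⟩ := hall n
  refine ⟨F, hF.mono fun x _ => ?_⟩
  rw [hn n le_rfl]
  exact ⟨x.1.2, x.2.2⟩

/-- The data are extended to the square as constant in the second variable, and the potential is
restricted to an edge. -/
theorem exists_isPotentialOn_unitInterval {U : ℝ → Set unitInterval}
    {N : unitInterval → ℝ → ℤ} (hUo : ∀ p, IsOpen (U p)) (hU : ∀ x, ∃ p, x ∈ U p)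
    (hN : ∀ p q x, x ∈ U p → x ∈ U q → ∀ᶠ y in 𝓝 x, N y p - N y q = N x p - N x q) :
    ∃ F, IsPotentialOn U N F Set.univ := by
  obtain ⟨F, hF⟩ := exists_isPotentialOn_unitSquare (U := fun p => Prod.fst ⁻¹' U p)
    (N := fun x => N x.1) (fun p => (hUo p).preimage continuous_fst) (fun x => hU x.1)
    (fun p q x hp hq => continuous_fst.continuousAt.eventually (hN p q x.1 hp hq))
  exact ⟨_, hF.comp (φ := fun x : unitInterval => (x, (0 : unitInterval))) (by fun_prop)⟩

end Potential

/-! ### Signed index as a cocycle, and telescoping of the flow -/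

section Flow

variable {H : Type*} [NormedAddCommGroup H] [InnerProductSpace ℂ H]

/-- The sum of `m Vⱼ sign (γⱼ - γⱼ₊₁)` for an integer-valued function `m` of subspaces. -/
noncomputable def FlowChoice.indexSum {B : unitInterval → H →ₗ.[ℂ] H} {δ : ℝ} (c : FlowChoice B δ)
    (m : Submodule ℂ H → ℕ) : ℤ :=
  ∑ j : Fin c.n, (m (c.V j) : ℤ) * (SignType.sign (c.lev j.castSucc - c.lev j.succ) : ℤ)

/-- The signed index of the part of `B` between the levels `p` and `q`. -/
noncomputable def signedIndex (m : Submodule ℂ H → ℕ) (B : H →ₗ.[ℂ] H) (p q : ℝ) : ℤ :=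
  (m (eigenSpan B (Set.uIoo p q)) : ℤ) * (SignType.sign (p - q) : ℤ)

theorem signedIndex_of_lt (m : Submodule ℂ H → ℕ) (B : H →ₗ.[ℂ] H) {p q : ℝ} (h : p < q) :
    signedIndex m B p q = -(m (eigenSpan B (Set.Ioo p q)) : ℤ) := by
  rw [signedIndex, Set.uIoo_of_lt h, sign_neg (sub_neg.2 h)]
  simp

theorem signedIndex_of_gt (m : Submodule ℂ H → ℕ) (B : H →ₗ.[ℂ] H) {p q : ℝ} (h : q < p) :
    signedIndex m B p q = m (eigenSpan B (Set.Ioo q p)) := by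
  rw [signedIndex, Set.uIoo_of_gt h, sign_pos (sub_pos.2 h)]
  simp

theorem signedIndex_self (m : Submodule ℂ H → ℕ) (B : H →ₗ.[ℂ] H) (p : ℝ) :
    signedIndex m B p p = 0 := by
  simp [signedIndex]

/-- The levels that may be used at a point `x` of the parameter space. -/
def goodSet {X : Type*} (B : X → H →ₗ.[ℂ] H) (δ p : ℝ) : Set X :=
  {x | p ∈ Set.Ioo (-δ) δ ∧ p ∉ spec (B x)}

/-- An index `m` that is additive on the spectral subspaces of a family `B` and locally constant
on those between two fixed levels outside of the spectrum. -/
structure IsFlowIndex {X : Type*} [TopologicalSpace X] (m : Submodule ℂ H → ℕ)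
    (B : X → H →ₗ.[ℂ] H) (δ : ℝ) : Prop where
  bot : m ⊥ = 0
  add : ∀ {x p q r}, x ∈ goodSet B δ p → x ∈ goodSet B δ q → x ∈ goodSet B δ r → p < q → q < r →
    m (eigenSpan (B x) (Set.Ioo p r)) =
      m (eigenSpan (B x) (Set.Ioo p q)) + m (eigenSpan (B x) (Set.Ioo q r))
  locallyConst : ∀ {x p q}, x ∈ goodSet B δ p → x ∈ goodSet B δ q → p < q →
    ∀ᶠ y in 𝓝 x, m (eigenSpan (B y) (Set.Ioo p q)) = m (eigenSpan (B x) (Set.Ioo p q))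

/-- `b` selects levels just below `0`: there is no spectrum in `[b x, 0)`. -/
def IsBaseLevel {X : Type*} (B : X → H →ₗ.[ℂ] H) (δ : ℝ) (b : X → ℝ) : Prop :=
  ∀ x, b x ∈ Set.Ioo (-δ) 0 ∧ ∀ c ∈ Set.Ico (b x) 0, c ∉ spec (B x)

theorem IsBaseLevel.mem_goodSet {X : Type*} {B : X → H →ₗ.[ℂ] H} {δ : ℝ} {b : X → ℝ} (hb : IsBaseLevel B δ b) (hδ : 0 < δ) (x : X) :
    x ∈ goodSet B δ (b x) :=
  ⟨⟨(hb x).1.1, (hb x).1.2.trans hδ⟩, (hb x).2 _ ⟨le_rfl, (hb x).1.2⟩⟩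

section

variable {X : Type*} [TopologicalSpace X] {m : Submodule ℂ H → ℕ} {B : X → H →ₗ.[ℂ] H} {δ : ℝ}

/-- The sign makes additivity over adjacent windows valid for every ordering of the three levels,
like an oriented integral. -/
theorem IsFlowIndex.signedIndex_add (h : IsFlowIndex m B δ) {x : X} {p q r : ℝ}
    (hp : x ∈ goodSet B δ p) (hq : x ∈ goodSet B δ q) (hr : x ∈ goodSet B δ r) :
    signedIndex m (B x) p q + signedIndex m (B x) q r = signedIndex m (B x) p r := by
  rcases lt_trichotomy p q with h1 | rfl | h1
  · rcases lt_trichotomy q r with h2 | rfl | h2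
    · have := h.add hp hq hr h1 h2
      simp only [signedIndex_of_lt, h1, h2, h1.trans h2]
      omega
    · simp [signedIndex_self]
    · rcases lt_trichotomy p r with h3 | rfl | h3
      · have := h.add hp hr hq h3 h2
        simp only [signedIndex_of_lt, signedIndex_of_gt, h1, h2, h3]
        omega
      · simp [signedIndex_self, signedIndex_of_lt, signedIndex_of_gt, h1]
      · have := h.add hr hp hq h3 h1
        simp only [signedIndex_of_lt, signedIndex_of_gt, h1, h2, h3]
        omega
  · simp [signedIndex_self]
  · rcases lt_trichotomy q r with h2 | rfl | h2
    · rcases lt_trichotomy p r with h3 | rfl | h3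
      · have := h.add hq hp hr h1 h3
        simp only [signedIndex_of_lt, signedIndex_of_gt, h1, h2, h3]
        omega
      · simp [signedIndex_self, signedIndex_of_lt, signedIndex_of_gt, h1]
      · have := h.add hq hr hp h2 h3
        simp only [signedIndex_of_lt, signedIndex_of_gt, h1, h2, h3]
        omega
    · simp [signedIndex_self]
    · have := h.add hr hq hp h2 h1
      simp only [signedIndex_of_gt, h1, h2, h2.trans h1]
      omega

theorem IsFlowIndex.eventually_signedIndex_eq (h : IsFlowIndex m B δ) {x : X} {p q : ℝ}
    (hp : x ∈ goodSet B δ p) (hq : x ∈ goodSet B δ q) :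
    ∀ᶠ y in 𝓝 x, signedIndex m (B y) p q = signedIndex m (B x) p q := by
  rcases lt_trichotomy p q with h1 | rfl | h1
  · filter_upwards [h.locallyConst hp hq h1] with y hy
    rw [signedIndex_of_lt _ _ h1, signedIndex_of_lt _ _ h1, hy]
  · exact Eventually.of_forall fun y => by simp [signedIndex_self]
  · filter_upwards [h.locallyConst hq hp h1] with y hy
    rw [signedIndex_of_gt _ _ h1, signedIndex_of_gt _ _ h1, hy]

theorem IsFlowIndex.signedIndex_eq_zero (h : IsFlowIndex m B δ) {x : X} {p q : ℝ}
    (hpq : ∀ c ∈ Set.uIoo p q, c ∉ spec (B x)) : signedIndex m (B x) p q = 0 := by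
  rw [signedIndex, eigenSpan_eq_bot hpq, h.bot, Nat.cast_zero, zero_mul]

/-- By the cocycle identity the reference level cancels and the difference is the signed index from
`p` to `q`. Hence `b` may be chosen pointwise, without any continuity. -/
theorem IsFlowIndex.eventually_sub_eq (h : IsFlowIndex m B δ) (hδ : 0 < δ)
    (hUo : ∀ p, IsOpen (goodSet B δ p)) {b : X → ℝ} (hb : IsBaseLevel B δ b) (p q : ℝ) (x : X)
    (hp : x ∈ goodSet B δ p) (hq : x ∈ goodSet B δ q) :
    ∀ᶠ y in 𝓝 x, signedIndex m (B y) p (b y) - signedIndex m (B y) q (b y) =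
      signedIndex m (B x) p (b x) - signedIndex m (B x) q (b x) := by
  filter_upwards [h.eventually_signedIndex_eq hp hq, (hUo p).mem_nhds hp,
    (hUo q).mem_nhds hq] with y hy hyp hyq
  rw [← h.signedIndex_add hp hq (hb.mem_goodSet hδ x),
    ← h.signedIndex_add hyp hyq (hb.mem_goodSet hδ y), hy]
  ring

end

/-- Summation by parts: `a j` and `b j` play the values at the right and left ends of cell `j`, and
the sum regroups them by interior partition points. -/
theorem sum_sub_eq_of_telescope {n : ℕ} (a b : Fin (n + 1) → ℤ) (f : Fin (n + 2) → ℤ)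
    (hab : ∀ j, a j - b j = f j.succ - f j.castSucc) (ha : a (Fin.last n) = 0) (hb : b 0 = 0) :
    ∑ j : Fin n, (a j.castSucc - b j.succ) = f (Fin.last (n + 1)) - f 0 := by
  have h1 := Fin.sum_univ_castSucc a
  have h2 := Fin.sum_univ_succ b
  have h3 := Fin.sum_univ_castSucc f
  have h4 := Fin.sum_univ_succ f
  have h5 : ∑ j, (a j - b j) = ∑ j : Fin (n + 1), (f j.succ - f j.castSucc) :=
    Finset.sum_congr rfl fun j _ => hab j
  rw [Finset.sum_sub_distrib, Finset.sum_sub_distrib] at h5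
  rw [Finset.sum_sub_distrib]
  omega

theorem IsFlowIndex.indexSum_eq {m : Submodule ℂ H → ℕ} {B : unitInterval → H →ₗ.[ℂ] H} {δ : ℝ}
    (h : IsFlowIndex m B δ) (hδ : 0 < δ) {b : unitInterval → ℝ} (hb : IsBaseLevel B δ b)
    {F : unitInterval → ℤ}
    (hF : IsPotentialOn (goodSet B δ) (fun x p => signedIndex m (B x) p (b x)) F Set.univ)
    (c : FlowChoice B δ) : c.indexSum m = F 1 - F 0 := by
  -- The two outermost boundary terms vanish: between the end level and the reference level there is
  -- no spectrum at the ends of the path. The case of end level 0 is included.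
  have hzero : ∀ x p, p ≤ 0 → (∀ r ∈ Set.Ico p 0, r ∉ spec (B x)) →
      signedIndex m (B x) p (b x) = 0 := by
    intro x p hp0 hp
    refine h.signedIndex_eq_zero fun r hr => ?_
    have hr0 : r < 0 := hr.2.trans_le (max_le hp0 (hb x).1.2.le)
    rcases min_lt_iff.1 hr.1 with h1 | h1
    · exact hp r ⟨h1.le, hr0⟩
    · exact (hb x).2 r ⟨h1.le, hr0⟩
  have hgood : ∀ j, Set.Icc (c.t j.castSucc) (c.t j.succ) ⊆ goodSet B δ (c.lev j) :=
    fun j s hs => ⟨c.lev_mem j, c.lev_notMem_spec j s hs⟩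
  have hle : ∀ j : Fin (c.n + 1), c.t j.castSucc ≤ c.t j.succ := fun j =>
    (c.strictMono Fin.castSucc_lt_succ).le
  have key := sum_sub_eq_of_telescope
    (fun j => signedIndex m (B (c.t j.succ)) (c.lev j) (b (c.t j.succ)))
    (fun j => signedIndex m (B (c.t j.castSucc)) (c.lev j) (b (c.t j.castSucc)))
    (fun i => F (c.t i)) (fun j => ?_) ?_ ?_
  · rw [← c.t_last, ← c.t_zero, ← key]
    refine Finset.sum_congr rfl fun j _ => ?_
    have h1 : c.t j.succ.castSucc ∈ goodSet B δ (c.lev j.castSucc) :=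
      hgood j.castSucc ⟨hle j.castSucc, le_rfl⟩
    have h2 : c.t j.succ.castSucc ∈ goodSet B δ (c.lev j.succ) := hgood j.succ ⟨le_rfl, hle j.succ⟩
    have h3 := h.signedIndex_add h1 h2 (hb.mem_goodSet hδ _)
    rw [Fin.succ_castSucc]
    exact eq_sub_of_add_eq h3
  · have := (hF.mono (Set.subset_univ _)).eq_of_isPreconnected (hgood j) isPreconnected_Icc
      ⟨le_rfl, hle j⟩ ⟨hle j, le_rfl⟩
    omega
  · simp only [Fin.succ_last, c.t_last]
    rw [← c.lev_zero_eq_last]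
    exact hzero 1 _ c.lev_zero_nonpos fun r hr => (c.ends_free r hr).2
  · simp only [Fin.castSucc_zero, c.t_zero]
    exact hzero 0 _ c.lev_zero_nonpos fun r hr => (c.ends_free r hr).1

end Flow

/-! ### Dimension and positive index as flow indices; admissible choices -/

section Indices

variable {H : Type*} [NormedAddCommGroup H] [InnerProductSpace ℂ H]
variable {X : Type*} [TopologicalSpace X] {B : X → H →ₗ.[ℂ] H} {δ : ℝ}

theorem IsRegularWith.comp {Y : Type*} [TopologicalSpace Y] (h : IsRegularWith B δ) {φ : Y → X}
    (hφ : Continuous φ) : IsRegularWith (fun y => B (φ y)) δ := by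
  obtain ⟨R, hRc, hR⟩ := h.continuous_resolvent
  exact ⟨h.pos, ⟨fun y => R (φ y), hRc.comp hφ, fun _ => hR _⟩, fun _ => h.discrete _⟩

variable [CompleteSpace H]

theorem IsRegularWith.isOpen_goodSet (h : IsRegularWith B δ) (p : ℝ) : IsOpen (goodSet B δ p) := by
  by_cases hp : p ∈ Set.Ioo (-δ) δ
  · convert h.isOpen_notMem_spec p using 1
    ext x
    exact and_iff_right hp
  · convert isOpen_empty
    exact Set.eq_empty_of_forall_notMem fun x hx => hp hx.1

theorem IsTameWith.comp {L : Submodule ℂ H} [L.HasOrthogonalProjection] {Y : Type*}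
    [TopologicalSpace Y] (h : IsTameWith L B δ) {φ : Y → X} (hφ : Continuous φ) :
    IsTameWith L (fun y => B (φ y)) δ :=
  ⟨h.toIsRegularWith.comp hφ, fun _ => h.commutator _⟩

theorem IsTameWith.orthogonal {L : Submodule ℂ H} [L.HasOrthogonalProjection]
    (h : IsTameWith L B δ) : IsTameWith Lᗮ B δ := by
  refine ⟨h.toIsRegularWith, fun x J hJ hJδ => ?_⟩
  have h1 : Lᗮ.starProjection = 1 - L.starProjection := Submodule.starProjection_orthogonal L
  rw [h1, sub_mul, mul_sub, one_mul, mul_one, sub_sub_sub_cancel_left, norm_sub_rev]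
  exact h.commutator x J hJ hJδ

theorem IsTameWith.almostCommutes {L : Submodule ℂ H} [L.HasOrthogonalProjection]
    (h : IsTameWith L B δ) {p q : ℝ} (hp : p ∈ Set.Ioo (-δ) δ) (hq : q ∈ Set.Ioo (-δ) δ) (x : X)
    [FiniteDimensional ℂ (eigenSpan (B x) (Set.Ioo p q))] :
    AlmostCommutes L (eigenSpan (B x) (Set.Ioo p q)) := by
  have := h.commutator x (Set.Ioo p q) Set.ordConnected_Ioo (Set.Ioo_subset_Ioo hp.1.le hq.2.le)
  rwa [eigenProj_eq] at this

theorem IsRegularWith.eventually_norm_sub_lt (h : IsRegularWith B δ)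
    (hB : ∀ x, IsSelfAdjoint (B x)) {x : X} {p q : ℝ} (hp : x ∈ goodSet B δ p)
    (hq : x ∈ goodSet B δ q) (hpq : p < q) {ε : ℝ} (hε : 0 < ε) :
    ∀ᶠ y in 𝓝 x, ‖eigenProj (B y) (Set.Ioo p q) - eigenProj (B x) (Set.Ioo p q)‖ < ε := by
  have h1 := h.continuousAt_eigenProj hB hp.1 hq.1 hpq hp.2 hq.2
  filter_upwards [h1 (Metric.ball_mem_nhds _ hε)] with y hy
  rwa [Set.mem_preimage, mem_ball_iff_norm] at hy

theorem IsRegularWith.isFlowIndex_finrank (h : IsRegularWith B δ)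
    (hB : ∀ x, IsSelfAdjoint (B x)) :
    IsFlowIndex (fun V : Submodule ℂ H => Module.finrank ℂ V) B δ where
  bot := finrank_bot ℂ H
  add {x p q r} hp hq hr hpq hqr := by
    have := h.finiteDimensional_eigenSpan hp.1 hq.1 x
    have := h.finiteDimensional_eigenSpan hq.1 hr.1 x
    rw [eigenSpan_Ioo_eq_sup hpq.le hqr.le hq.2]
    exact finrank_sup_of_isOrtho (isOrtho_eigenSpan (hB x) (Set.disjoint_left.2 fun _ h₁ h₂ => h₁.2.not_gt h₂.1))
  locallyConst {x p q} hp hq hpq := by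
    filter_upwards [h.eventually_norm_sub_lt hB hp hq hpq one_pos] with y hy
    have := h.finiteDimensional_eigenSpan hp.1 hq.1 x
    have := h.finiteDimensional_eigenSpan hp.1 hq.1 y
    rw [eigenProj_eq, eigenProj_eq] at hy
    exact finrank_eq_of_norm_starProjection_sub_lt hy

theorem IsTameWith.isFlowIndex_posIndex {L : Submodule ℂ H} [L.HasOrthogonalProjection]
    (h : IsTameWith L B δ) (hB : ∀ x, IsSelfAdjoint (B x)) :
    IsFlowIndex (posIndex L) B δ where
  bot := by
    have := posIndex_add_posIndex_orthogonal_le L (⊥ : Submodule ℂ H)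
    rw [finrank_bot] at this
    omega
  add {x p q r} hp hq hr hpq hqr := by
    have := h.finiteDimensional_eigenSpan hp.1 hq.1 x
    have := h.finiteDimensional_eigenSpan hq.1 hr.1 x
    rw [eigenSpan_Ioo_eq_sup hpq.le hqr.le hq.2]
    exact posIndex_sup (h.almostCommutes hp.1 hq.1 x) (h.almostCommutes hq.1 hr.1 x)
      (isOrtho_eigenSpan (hB x) (Set.disjoint_left.2 fun _ h₁ h₂ => h₁.2.not_gt h₂.1))
  locallyConst {x p q} hp hq hpq := by
    filter_upwards [h.eventually_norm_sub_lt hB hp hq hpq (by norm_num : (0 : ℝ) < 1 / 4)]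
      with y hy
    have := h.finiteDimensional_eigenSpan hp.1 hq.1 x
    have := h.finiteDimensional_eigenSpan hp.1 hq.1 y
    rw [eigenProj_eq, eigenProj_eq] at hy
    exact posIndex_eq_of_norm_starProjection_sub_lt (h.almostCommutes hp.1 hq.1 y)
      (h.almostCommutes hp.1 hq.1 x) hy

theorem IsRegularWith.exists_baseLevel (h : IsRegularWith B δ) :
    ∃ b : X → ℝ, IsBaseLevel B δ b := by
  have key : ∀ x, ∃ b : ℝ, b ∈ Set.Ioo (-δ) 0 ∧ ∀ c ∈ Set.Ico b 0, c ∉ spec (B x) := by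
    intro x
    have hδ := h.pos
    have hf : ((spec (B x) ∩ Set.Icc (-(δ / 2)) 0) \ {0}).Finite :=
      -- Zero may itself be an eigenvalue, so it is removed; the finite remainder stays away from 0.
      (h.finite_spec_inter_Icc ⟨by linarith, by linarith⟩ ⟨by linarith, hδ⟩ x).sdiff
    have h0 : (0 : ℝ) ∈ ((spec (B x) ∩ Set.Icc (-(δ / 2)) 0) \ {0})ᶜ := by simp
    obtain ⟨ε, hε, hball⟩ := Metric.mem_nhds_iff.1 (hf.isClosed.isOpen_compl.mem_nhds h0)
    have hmin : 0 < min (δ / 2) (ε / 2) := lt_min (by linarith) (by linarith)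
    refine ⟨-min (δ / 2) (ε / 2), ⟨?_, by linarith⟩, fun c hc hcs => ?_⟩
    · linarith [min_le_left (δ / 2) (ε / 2)]
    · have h1 : c ∈ Metric.ball (0 : ℝ) ε := by
        rw [Metric.mem_ball, dist_zero_right, Real.norm_eq_abs, abs_of_neg hc.2]
        linarith [hc.1, min_le_right (δ / 2) (ε / 2)]
      exact hball h1 ⟨⟨hcs, by linarith [hc.1, min_le_left (δ / 2) (ε / 2)], hc.2.le⟩, hc.2.ne⟩
  choose b hb using key
  exact ⟨b, hb⟩

theorem IsRegularWith.exists_isPotentialOn_square {B : unitInterval × unitInterval → H →ₗ.[ℂ] H}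
    (h : IsRegularWith B δ) {m : Submodule ℂ H → ℕ} (hm : IsFlowIndex m B δ)
    {b : unitInterval × unitInterval → ℝ} (hb : IsBaseLevel B δ b) :
    ∃ F, IsPotentialOn (goodSet B δ) (fun x p => signedIndex m (B x) p (b x)) F Set.univ :=
  exists_isPotentialOn_unitSquare h.isOpen_goodSet (fun x => ⟨b x, hb.mem_goodSet h.pos x⟩)
    (hm.eventually_sub_eq h.pos h.isOpen_goodSet hb)

theorem IsRegularWith.exists_indexSum_eq {B : unitInterval → H →ₗ.[ℂ] H}
    (h : IsRegularWith B δ) {m : Submodule ℂ H → ℕ} (hm : IsFlowIndex m B δ) :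
    ∃ k : ℤ, ∀ c : FlowChoice B δ, c.indexSum m = k := by
  obtain ⟨b, hb⟩ := h.exists_baseLevel
  obtain ⟨F, hF⟩ := exists_isPotentialOn_unitInterval h.isOpen_goodSet
    (fun x => ⟨b x, hb.mem_goodSet h.pos x⟩) (hm.eventually_sub_eq h.pos h.isOpen_goodSet hb)
  exact ⟨F 1 - F 0, fun c => hm.indexSum_eq h.pos hb hF c⟩

theorem unitInterval_dist_le_of_mem_Icc {a b s : unitInterval} (hs : s ∈ Set.Icc a b) :
    dist s a ≤ b - a ∧ dist s b ≤ (b : ℝ) - a := by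
  have h1 : (a : ℝ) ≤ s := hs.1
  have h2 : (s : ℝ) ≤ b := hs.2
  rw [Subtype.dist_eq, Subtype.dist_eq, Real.dist_eq, Real.dist_eq]
  constructor <;> rw [abs_le] <;> constructor <;> linarith

/-- A uniform partition with mesh below a Lebesgue number admits a level on every cell; only the two
end cells need care, as they must share a level just below 0. -/
theorem IsRegularWith.nonempty_flowChoice {B : unitInterval → H →ₗ.[ℂ] H}
    (h : IsRegularWith B δ) : Nonempty (FlowChoice B δ) := by
  classical
  obtain ⟨b, hb⟩ := h.exists_baseLevel
  have hδ := h.pos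
  obtain ⟨ε, hε, hleb⟩ := lebesgue_number_lemma_of_metric (isCompact_univ (X := unitInterval))
    h.isOpen_goodSet (fun x _ => Set.mem_iUnion.2 ⟨b x, hb.mem_goodSet hδ x⟩)
  choose lvl hlvl using fun x => hleb x (Set.mem_univ x)
  -- The higher of the two reference levels leaves `[g, 0)` free of spectrum at both ends.
  set g := max (b 0) (b 1) with hg
  have hg0 : g < 0 := max_lt (hb 0).1.2 (hb 1).1.2
  have hgδ : g ∈ Set.Ioo (-δ) δ := ⟨(hb 0).1.1.trans_le (le_max_left _ _), hg0.trans hδ⟩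
  have hfree : ∀ c ∈ Set.Ico g 0, c ∉ spec (B 0) ∧ c ∉ spec (B 1) := fun c hc =>
    ⟨(hb 0).2 c ⟨(le_max_left _ _).trans hc.1, hc.2⟩,
      (hb 1).2 c ⟨(le_max_right _ _).trans hc.1, hc.2⟩⟩
  have hgfree := hfree g ⟨le_rfl, hg0⟩
  obtain ⟨ε₀, hε₀, hball₀⟩ := Metric.mem_nhds_iff.1
    ((h.isOpen_goodSet g).mem_nhds (x := 0) ⟨hgδ, hgfree.1⟩)
  obtain ⟨ε₁, hε₁, hball₁⟩ := Metric.mem_nhds_iff.1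
    ((h.isOpen_goodSet g).mem_nhds (x := 1) ⟨hgδ, hgfree.2⟩)
  -- The mesh is also small enough for `g` to stay outside the spectrum on the whole first and last
  -- cells.
  obtain ⟨n, hn⟩ := exists_nat_one_div_lt (lt_min hε (lt_min hε₀ hε₁))
  rw [lt_min_iff, lt_min_iff] at hn
  have hn1 : (0 : ℝ) < n + 1 := by positivity
  let t : Fin (n + 2) → unitInterval := fun i => ⟨(i : ℝ) / (n + 1), by positivity, by
    rw [div_le_one hn1]
    exact_mod_cast Nat.lt_succ_iff.1 i.2⟩
  have ht0 : t 0 = 0 := Subtype.ext (by simp [t])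
  have ht1 : t (Fin.last (n + 1)) = 1 := Subtype.ext (by simp [t, hn1.ne'])
  have hstep : ∀ j : Fin (n + 1), (t j.succ : ℝ) - t j.castSucc = 1 / (n + 1) := fun j => by
    simp only [t, Fin.val_succ, Fin.val_castSucc]
    push_cast
    ring
  let lev : Fin (n + 1) → ℝ := fun j =>
    if j = 0 ∨ j = Fin.last n then g else lvl (t j.castSucc)
  have hlev : ∀ j, ∀ s ∈ Set.Icc (t j.castSucc) (t j.succ), s ∈ goodSet B δ (lev j) := by
    intro j s hs
    have hd := unitInterval_dist_le_of_mem_Icc hs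
    rw [hstep] at hd
    by_cases hj : j = 0 ∨ j = Fin.last n
    · simp only [lev, if_pos hj]
      rcases hj with rfl | rfl
      · rw [Fin.castSucc_zero, ht0] at hd
        exact hball₀ (hd.1.trans_lt hn.2.1)
      · rw [Fin.succ_last, ht1] at hd
        exact hball₁ (hd.2.trans_lt hn.2.2)
    · simp only [lev, if_neg hj]
      exact hlvl _ (hd.1.trans_lt hn.1)
  have hl0 : lev 0 = g := if_pos (Or.inl rfl)
  have hll : lev (Fin.last n) = g := if_pos (Or.inr rfl)
  refine ⟨⟨n, t, lev, fun i j hij => ?_, ht0, ht1, fun j => ?_, fun j s hs => (hlev j s hs).2,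
    hl0.trans hll.symm, hl0.trans_le hg0.le, ?_⟩⟩
  · change ((i : ℕ) : ℝ) / (n + 1) < ((j : ℕ) : ℝ) / (n + 1)
    gcongr
    exact hij
  · refine (hlev j (t j.castSucc) ⟨le_rfl, ?_⟩).1
    have : (0 : ℝ) < 1 / (n + 1) := by positivity
    exact Subtype.coe_le_coe.1 (by linarith [hstep j])
  · rw [hl0]
    exact hfree

/-- Enlarging the bound on the levels. -/
def FlowChoice.ofLE {B : unitInterval → H →ₗ.[ℂ] H} {δ δ' : ℝ} (c : FlowChoice B δ)
    (h : δ ≤ δ') : FlowChoice B δ' where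
  n := c.n
  t := c.t
  lev := c.lev
  strictMono := c.strictMono
  t_zero := c.t_zero
  t_last := c.t_last
  lev_mem j := Set.Ioo_subset_Ioo (neg_le_neg h) h (c.lev_mem j)
  lev_notMem_spec := c.lev_notMem_spec
  lev_zero_eq_last := c.lev_zero_eq_last
  lev_zero_nonpos := c.lev_zero_nonpos
  ends_free := c.ends_free

/-- A choice for the smaller bound is also one for the larger, so both sums can be compared there.
-/
theorem indexSum_eq_indexSum {B : unitInterval → H →ₗ.[ℂ] H} {m : Submodule ℂ H → ℕ} {δ δ' : ℝ}
    (h : IsRegularWith B δ) (hm : IsFlowIndex m B δ) (h' : IsRegularWith B δ')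
    (hm' : IsFlowIndex m B δ') (c : FlowChoice B δ) (c' : FlowChoice B δ') :
    c.indexSum m = c'.indexSum m := by
  rcases le_total δ δ' with hle | hle
  · obtain ⟨k, hk⟩ := h'.exists_indexSum_eq hm'
    exact (hk (c.ofLE hle)).trans (hk c').symm
  · obtain ⟨k, hk⟩ := h.exists_indexSum_eq hm
    exact (hk c).trans (hk (c'.ofLE hle)).symm

theorem FlowChoice.partialSum_eq_partialSpectralFlow {L : Submodule ℂ H}
    [L.HasOrthogonalProjection] {B : unitInterval → H →ₗ.[ℂ] H} (hB : ∀ t, IsSelfAdjoint (B t))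
    (h : IsTameWith L B δ) (c : FlowChoice B δ) : c.partialSum L = partialSpectralFlow L B := by
  have hex : ∃ m : ℤ, ∃ δ : ℝ, IsTameWith L B δ ∧ ∃ c : FlowChoice B δ, c.partialSum L = m :=
    ⟨_, δ, h, c, rfl⟩
  rw [partialSpectralFlow, dif_pos hex]
  obtain ⟨δ', h', c', hc'⟩ := hex.choose_spec
  rw [← hc']
  exact indexSum_eq_indexSum h.toIsRegularWith (h.isFlowIndex_posIndex hB) h'.toIsRegularWith
    (h'.isFlowIndex_posIndex hB) c c'

theorem FlowChoice.fullSum_eq_spectralFlow {B : unitInterval → H →ₗ.[ℂ] H}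
    (hB : ∀ t, IsSelfAdjoint (B t)) (h : IsRegularWith B δ) (c : FlowChoice B δ) :
    c.fullSum = spectralFlow B := by
  have hex : ∃ m : ℤ, ∃ δ : ℝ, IsRegularWith B δ ∧ ∃ c : FlowChoice B δ, c.fullSum = m :=
    ⟨_, δ, h, c, rfl⟩
  rw [spectralFlow, dif_pos hex]
  obtain ⟨δ', h', c', hc'⟩ := hex.choose_spec
  rw [← hc']
  exact indexSum_eq_indexSum h (h.isFlowIndex_finrank hB) h' (h'.isFlowIndex_finrank hB) c c'

theorem FlowChoice.partialSum_add_partialSum_orthogonal {L : Submodule ℂ H}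
    [L.HasOrthogonalProjection] {B : unitInterval → H →ₗ.[ℂ] H} (h : IsTameWith L B δ)
    (c : FlowChoice B δ) : c.partialSum L + c.partialSum Lᗮ = c.fullSum := by
  rw [FlowChoice.partialSum, FlowChoice.partialSum, FlowChoice.fullSum, ← Finset.sum_add_distrib]
  refine Finset.sum_congr rfl fun j _ => ?_
  have hmem : ∀ i k, min (c.lev i) (c.lev k) ∈ Set.Ioo (-δ) δ ∧
      max (c.lev i) (c.lev k) ∈ Set.Ioo (-δ) δ := fun i k =>
    ⟨⟨lt_min (c.lev_mem i).1 (c.lev_mem k).1, min_lt_of_left_lt (c.lev_mem i).2⟩,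
      ⟨lt_max_of_lt_left (c.lev_mem i).1, max_lt (c.lev_mem i).2 (c.lev_mem k).2⟩⟩
  obtain ⟨h1, h2⟩ := hmem j.castSucc j.succ
  have := h.finiteDimensional_eigenSpan h1 h2 (c.t j.succ.castSucc)
  have h3 := (h.almostCommutes h1 h2 (c.t j.succ.castSucc)).posIndex_add_posIndex_orthogonal
  rw [← add_mul, ← Nat.cast_add]
  exact congrArg (fun k : ℕ => (k : ℤ) * _) h3

/-- The potential on the square pulls back along any path, so a single `F` computes the flow along
all of them. -/
theorem IsTameWith.exists_partialSpectralFlow_eq {L : Submodule ℂ H} [L.HasOrthogonalProjection]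
    {B : unitInterval × unitInterval → H →ₗ.[ℂ] H} (hB : ∀ x, IsSelfAdjoint (B x))
    (h : IsTameWith L B δ) :
    ∃ F : unitInterval × unitInterval → ℤ, ∀ φ : unitInterval → unitInterval × unitInterval,
      Continuous φ → partialSpectralFlow L (fun t => B (φ t)) = F (φ 1) - F (φ 0) := by
  obtain ⟨b, hb⟩ := h.exists_baseLevel
  obtain ⟨F, hF⟩ := h.exists_isPotentialOn_square (h.isFlowIndex_posIndex hB) hb
  refine ⟨F, fun φ hφ => ?_⟩
  have h' := h.comp hφ
  obtain ⟨c⟩ := h'.nonempty_flowChoice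
  rw [← c.partialSum_eq_partialSpectralFlow (fun t => hB (φ t)) h']
  exact (h'.isFlowIndex_posIndex fun t => hB (φ t)).indexSum_eq h'.pos (b := fun t => b (φ t))
    (fun t => hb (φ t)) (hF.comp hφ) c

end Indices

end PartialFlow

theorem theorem1 {H : Type*} [NormedAddCommGroup H] [InnerProductSpace ℂ H] [CompleteSpace H]
    (L : Submodule ℂ H) [L.HasOrthogonalProjection] :
    (∀ B : unitInterval → H →ₗ.[ℂ] H, (∀ t, IsSelfAdjoint (B t)) → PartialFlow.IsTame L B →
      -- the flow along `L` is well defined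
      (∀ δ : ℝ, PartialFlow.IsTameWith L B δ →
        Nonempty (PartialFlow.FlowChoice B δ) ∧
        ∀ c : PartialFlow.FlowChoice B δ,
          c.partialSum L = PartialFlow.partialSpectralFlow L B) ∧
      -- the family is tame along the complement, and the flow along it is well defined
      PartialFlow.IsTame Lᗮ B ∧
      (∀ δ : ℝ, PartialFlow.IsTameWith Lᗮ B δ →
        Nonempty (PartialFlow.FlowChoice B δ) ∧
        ∀ c : PartialFlow.FlowChoice B δ,
          c.partialSum Lᗮ = PartialFlow.partialSpectralFlow Lᗮ B) ∧
      -- the same for the ordinary flow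
      (∀ δ : ℝ, PartialFlow.IsRegularWith B δ →
        Nonempty (PartialFlow.FlowChoice B δ) ∧
        ∀ c : PartialFlow.FlowChoice B δ, c.fullSum = PartialFlow.spectralFlow B) ∧
      PartialFlow.partialSpectralFlow L B + PartialFlow.partialSpectralFlow Lᗮ B =
        PartialFlow.spectralFlow B) ∧
    (∀ B : unitInterval × unitInterval → H →ₗ.[ℂ] H, (∀ p, IsSelfAdjoint (B p)) →
      PartialFlow.IsTame L B →
      PartialFlow.partialSpectralFlow L (fun t => B (0, t)) =
        PartialFlow.partialSpectralFlow L (fun t => B (1, t)) →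
      PartialFlow.partialSpectralFlow L (fun t => B (t, 0)) =
        PartialFlow.partialSpectralFlow L (fun t => B (t, 1))) := by
  open PartialFlow in
  refine ⟨fun B hB hL => ?_, fun B hB hL heq => ?_⟩
  · obtain ⟨δ, h⟩ := hL
    refine ⟨fun δ' h' => ⟨h'.nonempty_flowChoice,
      fun c => c.partialSum_eq_partialSpectralFlow hB h'⟩, ⟨δ, h.orthogonal⟩,
      fun δ' h' => ⟨h'.nonempty_flowChoice, fun c => c.partialSum_eq_partialSpectralFlow hB h'⟩,
      fun δ' h' => ⟨h'.nonempty_flowChoice, fun c => c.fullSum_eq_spectralFlow hB h'⟩, ?_⟩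
    obtain ⟨c⟩ := h.nonempty_flowChoice
    rw [← c.partialSum_eq_partialSpectralFlow hB h,
      ← c.partialSum_eq_partialSpectralFlow hB h.orthogonal,
      ← c.fullSum_eq_spectralFlow hB h.toIsRegularWith]
    exact c.partialSum_add_partialSum_orthogonal h
  · obtain ⟨δ, h⟩ := hL
    obtain ⟨F, hF⟩ := h.exists_partialSpectralFlow_eq hB
    -- Each flow along a side is a difference of corner values; equality on one pair of opposite
    -- sides rearranges to equality on the other.
    rw [hF (fun t => (0, t)) (by fun_prop), hF (fun t => (1, t)) (by fun_prop)] at heq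
    rw [hF (fun t => (t, 0)) (by fun_prop), hF (fun t => (t, 1)) (by fun_prop)]
    omega
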